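/- An abstract Krivine structure (aks) $\mathcal K$ consists of a set $\Lambda$ of terms with a binary operation $t,s\mapsto t\cdot s$ and elements $\mathsf K,\mathsf S,\mathsf{cc}$; a subset $\mathsf{QP}\subseteq\Lambda$ (quasi-proofs) containing these elements and closed under $\cdot$; a set $\Pi$ of stacks with operations $t,\pi\mapsto t.\pi:\Lambda\times\Pi\to\Pi$ and $\pi\mapsto k_\pi:\Pi\to\Lambda$; and a pole $\perp\!\!\!\perp\subseteq\Lambda\times\Pi$ such that $(t,s.\pi)\in\perp\!\!\!\perp$ implies $(t\cdot s,\pi)\in\perp\!\!\!\perp$; $(t,\pi)\in\perp\!\!\!\perp$ implies $(\mathsf K,t.s.\pi)\in\perp\!\!\!\perp$ and $(k_\pi,t.\pi')\in\perp\!\!\!\perp$; $((t\cdot u)\cdot(s\cdot u),\pi)\in\perp\!\!\!\perp$ implies $(\mathsf S,t.s.u.\pi)\in\perp\!\!\!\perp$; and $(t,k_\pi.\pi)\in\perp\!\!\!\perp$ implies $(\mathsf{cc},t.\pi)\in\perp\!\!\!\perp$. Call $\mathcal K$ nondegenerate if no quasi-proof is orthogonal to all stacks, i.e. for every $t\in\mathsf{QP}$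 there is $\pi\in\Pi$ with $(t,\pi)\notin\perp\!\!\!\perp$. For $\alpha\subseteq\Pi$ let $|\alpha|=\{t\mid\forall\pi\in\alpha,\ (t,\pi)\in\perp\!\!\!\perp\}$. The biorthogonally closed subsets of $\Pi$, ordered by reverse inclusion, with application $\alpha\bullet\beta$ the biorthogonal closure of $\{\pi\mid\forall t\in|\alpha|\,\forall s\in|\beta|,\ (t,s.\pi)\in\perp\!\!\!\perp\}$ and with filter $\Phi=\{\alpha\mid|\alpha|\cap\mathsf{QP}\ne\emptyset\}$, form a filtered opca $\Sigma_{\mathcal K}$; here a filtered opca $(A,A')$ is an order-pca $A$ with a subset $A'$ (the filter) which is closed under application and contains choices of $\mathsf k$ and $\mathsf s$ for $A$. The Krivine tripos of $\mathcal K$ is the Set-indexed preorder $[-,\Sigma_{\mathcal K}]$, in which $\phi\le\psi$ for $\phi,\psi:I\to\Sigma_{\mathcal K}$ iff there is $a\in\Phi$ with $a\bullet\phi(i)\le\psi(i)$ for all $i\in I$. For a filtered opca $(A,A')$, the Set-indexed preorder $[-,\mathcal D(A,A')]$ consists of the functions $\phi$ from $I$ to the set $\mathcal DA$ of downsets of $A$,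 with $\phi\le\psi$ iff there is $a\in A'$ such that for all $i\in I$ and $b\in\phi(i)$, $ab$ is defined and in $\psi(i)$; when it is a tripos, the topos it represents is $\mathsf{RT}(A',A)$. For a downset $U$ of $A$ and $\alpha\in\mathcal DA$ put $(\alpha\to U)=\{a\in A\mid\forall b\in\alpha,\ ab\text{ is defined and }ab\in U\}$. The Booleanization of $[-,\mathcal D(A,A')]$ with respect to $U$ consists of the same functions $\phi:I\to\mathcal DA$, preordered by: $\phi\le\psi$ iff $(\psi\to U)\le(\phi\to U)$ in $[I,\mathcal D(A,A')]$. **Theorem.** For every abstract Krivine structure $\mathcal K$ there are a filtered opca $(A,A')$ and a downset $U$ of $A$ such that: 1. if $\mathcal K$ is nondegenerate, then $U\cap A'=\emptyset$; 2. the Krivine tripos of $\mathcal K$ is equivalent, as a Set-indexed preorder, to the Booleanization of $[-,\mathcal D(A,A')]$ with respect to $U$; 3. the Krivine tripos of $\mathcal K$ and $[-,\mathcal D(A,A')]$ are triposes, and the topos represented by the Krivine tripos is equivalent to the Booleanization (the topos of double-negation sheaves) of the closed subtopos of $\mathsf{RT}(A',A)$ complementary to the subterminal object given by $U$. -/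

import Mathlib

open CategoryTheory

universe u

namespace KrivineTripos

/-! ### Set-indexed preorders of the form `I ↦ (I → Val)` -/

/-- A Set-indexed preorder whose fibre over a set `I` is the set of all functions `I → Val`
(with some preorder) and whose reindexing maps are given by precomposition. -/
structure IndexedPreorder where
  Val : Type u
  le : ∀ {I : Type u}, (I → Val) → (I → Val) → Prop
  le_refl : ∀ {I : Type u} (φ : I → Val), le φ φ
  le_trans : ∀ {I : Type u} {φ ψ χ : I → Val}, le φ ψ → le ψ χ → le φ χ
  le_reindex : ∀ {I J : Type u} (f : J → I) {φ ψ : I → Val},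
    le φ ψ → le (fun j => φ (f j)) (fun j => ψ (f j))

namespace IndexedPreorder

/-- Isomorphism of two elements of a fibre. -/
def Iso (P : IndexedPreorder.{u}) {I : Type u} (φ ψ : I → P.Val) : Prop :=
  P.le φ ψ ∧ P.le ψ φ

/-- A transformation of Set-indexed preorders: order preserving maps between the fibres,
commuting with reindexing up to isomorphism. -/
structure Transf (P Q : IndexedPreorder.{u}) where
  map : ∀ {I : Type u}, (I → P.Val) → (I → Q.Val)
  mono : ∀ {I : Type u} {φ ψ : I → P.Val}, P.le φ ψ → Q.le (map φ) (map ψ)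
  natural : ∀ {I J : Type u} (f : J → I) (φ : I → P.Val),
    Q.Iso (map (fun j => φ (f j))) (fun j => map φ (f j))

/-- Equivalence of Set-indexed preorders. -/
def Equivalent (P Q : IndexedPreorder.{u}) : Prop :=
  ∃ (F : Transf P Q) (G : Transf Q P),
    (∀ {I : Type u} (φ : I → P.Val), P.Iso (G.map (F.map φ)) φ) ∧
    (∀ {I : Type u} (ψ : I → Q.Val), Q.Iso (F.map (G.map ψ)) ψ)

/-- The structure making a Set-indexed preorder of the form `I ↦ (I → Val)` a tripos:
every fibre is a Heyting prealgebra and reindexing preserves the Heyting structure (both are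
expressed by having the operations on `Val` and applying them pointwise), and all reindexing maps
have left and right adjoints satisfying the Beck-Chevalley condition for pullback squares of sets.
The identity function on `Val` is a generic predicate. All of this structure is unique up to
isomorphism. -/
structure Tripos (P : IndexedPreorder.{u}) where
  top : P.Val
  bot : P.Val
  inf : P.Val → P.Val → P.Val
  sup : P.Val → P.Val → P.Val
  himp : P.Val → P.Val → P.Val
  ex : ∀ {I J : Type u}, (I → J) → (I → P.Val) → (J → P.Val)
  all : ∀ {I J : Type u}, (I → J) → (I → P.Val) → (J → P.Val)
  le_top : ∀ {I : Type u} (φ : I → P.Val), P.le φ (fun _ => top)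
  bot_le : ∀ {I : Type u} (φ : I → P.Val), P.le (fun _ => bot) φ
  le_inf_iff : ∀ {I : Type u} (φ ψ χ : I → P.Val),
    P.le χ (fun i => inf (φ i) (ψ i)) ↔ P.le χ φ ∧ P.le χ ψ
  sup_le_iff : ∀ {I : Type u} (φ ψ χ : I → P.Val),
    P.le (fun i => sup (φ i) (ψ i)) χ ↔ P.le φ χ ∧ P.le ψ χ
  le_himp_iff : ∀ {I : Type u} (φ ψ χ : I → P.Val),
    P.le χ (fun i => himp (φ i) (ψ i)) ↔ P.le (fun i => inf (χ i) (φ i)) ψ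
  ex_le_iff : ∀ {I J : Type u} (f : I → J) (φ : I → P.Val) (ψ : J → P.Val),
    P.le (ex f φ) ψ ↔ P.le φ (fun i => ψ (f i))
  le_all_iff : ∀ {I J : Type u} (f : I → J) (φ : I → P.Val) (ψ : J → P.Val),
    P.le ψ (all f φ) ↔ P.le (fun i => ψ (f i)) φ
  ex_beckChevalley : ∀ {I J K : Type u} (f : I → J) (g : K → J) (φ : I → P.Val),
    P.Iso (fun k => ex f φ (g k))
      (ex (fun p : {p : K × I // g p.1 = f p.2} => p.1.1) (fun p => φ p.1.2))
  all_beckChevalley : ∀ {I J K : Type u} (f : I → J) (g : K → J) (φ : I → P.Val),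
    P.Iso (fun k => all f φ (g k))
      (all (fun p : {p : K × I // g p.1 = f p.2} => p.1.1) (fun p => φ p.1.2))

namespace Tripos

variable {P : IndexedPreorder.{u}} (T : P.Tripos)

/-- Existential quantification over a variable ranging over the set `Y`. -/
def some {I Y : Type u} (φ : I → Y → P.Val) : I → P.Val :=
  T.ex (fun p : I × Y => p.1) (fun p => φ p.1 p.2)

theorem inf_intro {I : Type u} {χ φ ψ : I → P.Val} (h₁ : P.le χ φ) (h₂ : P.le χ ψ) :
    P.le χ (fun i => T.inf (φ i) (ψ i)) :=
  (T.le_inf_iff φ ψ χ).2 ⟨h₁, h₂⟩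

theorem inf_left {I : Type u} {χ φ ψ : I → P.Val}
    (h : P.le χ (fun i => T.inf (φ i) (ψ i))) : P.le χ φ :=
  ((T.le_inf_iff φ ψ χ).1 h).1

theorem inf_right {I : Type u} {χ φ ψ : I → P.Val}
    (h : P.le χ (fun i => T.inf (φ i) (ψ i))) : P.le χ ψ :=
  ((T.le_inf_iff φ ψ χ).1 h).2

theorem some_intro {I Y K : Type u} (φ : I → Y → P.Val) (g : K → I) (y : K → Y)
    {χ : K → P.Val} (h : P.le χ (fun k => φ (g k) (y k))) :
    P.le χ (fun k => T.some φ (g k)) := by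
  have h0 : P.le (fun p : I × Y => φ p.1 p.2) (fun p => T.some φ p.1) :=
    (T.ex_le_iff (fun p : I × Y => p.1) (fun p => φ p.1 p.2) (T.some φ)).1 (P.le_refl _)
  exact P.le_trans h (P.le_reindex (fun k => (g k, y k)) h0)

theorem some_elim {I Y K : Type u} {φ : I → Y → P.Val} {g : K → I} {γ χ : K → P.Val}
    (h : P.le γ (fun k => T.some φ (g k)))
    (h' : P.le (fun p : K × Y => T.inf (γ p.1) (φ (g p.1) p.2)) (fun p => χ p.1)) :
    P.le γ χ := by
  have h1 := P.le_trans h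
    (T.ex_beckChevalley (fun p : I × Y => p.1) g (fun p => φ p.1 p.2)).1
  have h2 : P.le (fun k => T.some φ (g k)) (fun k => T.himp (γ k) (χ k)) := by
    refine P.le_trans
      (T.ex_beckChevalley (fun p : I × Y => p.1) g (fun p => φ p.1 p.2)).1 ?_
    rw [T.ex_le_iff, T.le_himp_iff]
    have h3 := P.le_reindex
      (fun p : {p : K × (I × Y) // g p.1 = p.2.1} => (p.1.1, p.1.2.2)) h'
    refine P.le_trans ?_ h3
    have e : (fun p : {p : K × (I × Y) // g p.1 = p.2.1} => φ p.1.2.1 p.1.2.2)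
        = fun p => φ (g p.1.1) p.1.2.2 := by
      funext p; rw [p.2]
    have h4 : P.le
        (fun p : {p : K × (I × Y) // g p.1 = p.2.1} => T.inf (φ p.1.2.1 p.1.2.2) (γ p.1.1))
        (fun p => φ (g p.1.1) p.1.2.2) := by
      rw [← e]; exact T.inf_left (P.le_refl _)
    exact T.inf_intro (T.inf_right (P.le_refl _)) h4
  have h5 := P.le_trans h h2
  rw [T.le_himp_iff] at h5
  exact P.le_trans (T.inf_intro (P.le_refl γ) (P.le_refl γ)) h5

/-! ### The tripos-to-topos construction -/

/-- The objects of the topos represented by a tripos: sets with a predicate of equality which is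
symmetric and transitive in the logic of the tripos. -/
structure Obj where
  X : Type u
  eq : X → X → P.Val
  symm : P.le (fun p : X × X => eq p.1 p.2) (fun p => eq p.2 p.1)
  trans : P.le (fun p : X × X × X => T.inf (eq p.1 p.2.1) (eq p.2.1 p.2.2))
    (fun p => eq p.1 p.2.2)

variable {T}

theorem Obj.symm' (A : Obj T) {K : Type u} {γ : K → P.Val} {x y : K → A.X}
    (h : P.le γ (fun k => A.eq (x k) (y k))) : P.le γ (fun k => A.eq (y k) (x k)) :=
  P.le_trans h (P.le_reindex (fun k => (x k, y k)) A.symm)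

theorem Obj.trans' (A : Obj T) {K : Type u} {γ : K → P.Val} {x y z : K → A.X}
    (h : P.le γ (fun k => A.eq (x k) (y k))) (h' : P.le γ (fun k => A.eq (y k) (z k))) :
    P.le γ (fun k => A.eq (x k) (z k)) :=
  P.le_trans (T.inf_intro h h') (P.le_reindex (fun k => (x k, y k, z k)) A.trans)

/-- Functional relations between two objects: relations which are, in the logic of the tripos,
strict, compatible with equality, single-valued and total. -/
structure FuncRel (A B : Obj T) where
  rel : A.X → B.X → P.Val
  strict : P.le (fun p : A.X × B.X => rel p.1 p.2)
    (fun p => T.inf (A.eq p.1 p.1) (B.eq p.2 p.2))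
  congr : P.le
    (fun p : (A.X × A.X) × (B.X × B.X) =>
      T.inf (rel p.1.1 p.2.1) (T.inf (A.eq p.1.1 p.1.2) (B.eq p.2.1 p.2.2)))
    (fun p => rel p.1.2 p.2.2)
  single : P.le (fun p : A.X × B.X × B.X => T.inf (rel p.1 p.2.1) (rel p.1 p.2.2))
    (fun p => B.eq p.2.1 p.2.2)
  total : P.le (fun x : A.X => A.eq x x) (T.some rel)

namespace FuncRel

variable {A B C D : Obj T}

theorem left (F : FuncRel A B) {K : Type u} {γ : K → P.Val} {x : K → A.X} {y : K → B.X}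
    (h : P.le γ (fun k => F.rel (x k) (y k))) : P.le γ (fun k => A.eq (x k) (x k)) :=
  T.inf_left (P.le_trans h (P.le_reindex (fun k => (x k, y k)) F.strict))

theorem right (F : FuncRel A B) {K : Type u} {γ : K → P.Val} {x : K → A.X} {y : K → B.X}
    (h : P.le γ (fun k => F.rel (x k) (y k))) : P.le γ (fun k => B.eq (y k) (y k)) :=
  T.inf_right (P.le_trans h (P.le_reindex (fun k => (x k, y k)) F.strict))

theorem congr' (F : FuncRel A B) {K : Type u} {γ : K → P.Val} {x x' : K → A.X}
    {y y' : K → B.X} (h : P.le γ (fun k => F.rel (x k) (y k)))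
    (hx : P.le γ (fun k => A.eq (x k) (x' k))) (hy : P.le γ (fun k => B.eq (y k) (y' k))) :
    P.le γ (fun k => F.rel (x' k) (y' k)) :=
  P.le_trans (T.inf_intro h (T.inf_intro hx hy))
    (P.le_reindex (fun k => ((x k, x' k), (y k, y' k))) F.congr)

theorem single' (F : FuncRel A B) {K : Type u} {γ : K → P.Val} {x : K → A.X}
    {y y' : K → B.X} (h : P.le γ (fun k => F.rel (x k) (y k)))
    (h' : P.le γ (fun k => F.rel (x k) (y' k))) : P.le γ (fun k => B.eq (y k) (y' k)) :=
  P.le_trans (T.inf_intro h h') (P.le_reindex (fun k => (x k, y k, y' k)) F.single)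

theorem total' (F : FuncRel A B) {K : Type u} {γ : K → P.Val} {x : K → A.X}
    (h : P.le γ (fun k => A.eq (x k) (x k))) : P.le γ (fun k => T.some F.rel (x k)) :=
  P.le_trans h (P.le_reindex x F.total)

/-- Functional relations are identified when they are isomorphic as predicates. -/
instance setoid (A B : Obj T) : Setoid (FuncRel A B) where
  r F G := P.Iso (fun p : A.X × B.X => F.rel p.1 p.2) (fun p => G.rel p.1 p.2)
  iseqv :=
    { refl := fun _ => ⟨P.le_refl _, P.le_refl _⟩
      symm := fun h => ⟨h.2, h.1⟩
      trans := fun h h' => ⟨P.le_trans h.1 h'.1, P.le_trans h'.2 h.2⟩ }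

theorem le_of_equiv {F G : FuncRel A B} (e : F ≈ G) {K : Type u} {γ : K → P.Val}
    {x : K → A.X} {y : K → B.X} (h : P.le γ (fun k => F.rel (x k) (y k))) :
    P.le γ (fun k => G.rel (x k) (y k)) :=
  P.le_trans h (P.le_reindex (fun k => (x k, y k)) e.1)

/-- The identity functional relation is the equality predicate. -/
def id (A : Obj T) : FuncRel A A where
  rel := A.eq
  strict := by
    have h := P.le_refl (fun p : A.X × A.X => A.eq p.1 p.2)
    exact T.inf_intro (A.trans' h (A.symm' h)) (A.trans' (A.symm' h) h)
  congr := by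
    have h := P.le_refl (fun p : (A.X × A.X) × (A.X × A.X) =>
      T.inf (A.eq p.1.1 p.2.1) (T.inf (A.eq p.1.1 p.1.2) (A.eq p.2.1 p.2.2)))
    have h1 := T.inf_left h
    have h2 := T.inf_left (T.inf_right h)
    have h3 := T.inf_right (T.inf_right h)
    exact A.trans' (A.symm' h2) (A.trans' h1 h3)
  single := by
    have h := P.le_refl (fun p : A.X × A.X × A.X => T.inf (A.eq p.1 p.2.1) (A.eq p.1 p.2.2))
    exact A.trans' (A.symm' (T.inf_left h)) (T.inf_right h)
  total := T.some_intro A.eq (fun x => x) (fun x => x) (P.le_refl _)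

/-- The relational composite `∃ y, F x y ∧ G y z`. -/
def compRel (F : FuncRel A B) (G : FuncRel B C) (x : A.X) (z : C.X) : P.Val :=
  T.some (fun (p : A.X × C.X) (y : B.X) => T.inf (F.rel p.1 y) (G.rel y p.2)) (x, z)

theorem compRel_intro (F : FuncRel A B) (G : FuncRel B C) {K : Type u} {γ : K → P.Val}
    {x : K → A.X} {z : K → C.X} (y : K → B.X) (h : P.le γ (fun k => F.rel (x k) (y k)))
    (h' : P.le γ (fun k => G.rel (y k) (z k))) :
    P.le γ (fun k => compRel F G (x k) (z k)) :=
  T.some_intro (fun (p : A.X × C.X) (y : B.X) => T.inf (F.rel p.1 y) (G.rel y p.2))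
    (fun k => (x k, z k)) y (T.inf_intro h h')

theorem compRel_elim (F : FuncRel A B) (G : FuncRel B C) {K : Type u} {γ χ : K → P.Val}
    {x : K → A.X} {z : K → C.X} (h : P.le γ (fun k => compRel F G (x k) (z k)))
    (h' : ∀ δ : K × B.X → P.Val, P.le δ (fun p => γ p.1) →
      P.le δ (fun p => F.rel (x p.1) p.2) → P.le δ (fun p => G.rel p.2 (z p.1)) →
      P.le δ (fun p => χ p.1)) : P.le γ χ := by
  refine T.some_elim
    (φ := fun (p : A.X × C.X) (y : B.X) => T.inf (F.rel p.1 y) (G.rel y p.2))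
    (g := fun k => (x k, z k)) h ?_
  have e := P.le_refl (fun p : K × B.X =>
    T.inf (γ p.1) (T.inf (F.rel (x p.1) p.2) (G.rel p.2 (z p.1))))
  exact h' _ (T.inf_left e) (T.inf_left (T.inf_right e)) (T.inf_right (T.inf_right e))

/-- Composition of functional relations. -/
def comp (F : FuncRel A B) (G : FuncRel B C) : FuncRel A C where
  rel := compRel F G
  strict := by
    refine compRel_elim F G (x := fun p : A.X × C.X => p.1) (z := fun p => p.2)
      (P.le_refl _) ?_
    intro δ _ h1 h2
    exact T.inf_intro (F.left h1) (G.right h2)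
  congr := by
    refine compRel_elim F G
      (x := fun p : (A.X × A.X) × (C.X × C.X) => p.1.1) (z := fun p => p.2.1)
      (T.inf_left (P.le_refl _)) ?_
    intro δ h h1 h2
    have h3 := T.inf_left (T.inf_right h)
    have h4 := T.inf_right (T.inf_right h)
    exact compRel_intro F G (fun p => p.2) (F.congr' h1 h3 (F.right h1))
      (G.congr' h2 (G.left h2) h4)
  single := by
    refine compRel_elim F G (x := fun p : A.X × C.X × C.X => p.1) (z := fun p => p.2.1)
      (T.inf_left (P.le_refl _)) ?_
    intro δ h h1 h2
    refine compRel_elim F G (x := fun p : (A.X × C.X × C.X) × B.X => p.1.1)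
      (z := fun p => p.1.2.2) (T.inf_right h) ?_
    intro ε h' h3 h4
    have h1' := P.le_trans h' (P.le_reindex Prod.fst h1)
    have h2' := P.le_trans h' (P.le_reindex Prod.fst h2)
    have e := F.single' h1' h3
    exact G.single' (G.congr' h2' e (G.right h2')) h4
  total := by
    refine T.some_elim (φ := F.rel) (g := fun x : A.X => x) F.total ?_
    have h := P.le_refl (fun p : A.X × B.X => T.inf (A.eq p.1 p.1) (F.rel p.1 p.2))
    refine T.some_elim (φ := G.rel) (g := fun p : A.X × B.X => p.2)
      (G.total' (F.right (T.inf_right h))) ?_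
    have h' := P.le_refl (fun p : (A.X × B.X) × C.X =>
      T.inf (T.inf (A.eq p.1.1 p.1.1) (F.rel p.1.1 p.1.2)) (G.rel p.1.2 p.2))
    exact T.some_intro (compRel F G) (fun p : (A.X × B.X) × C.X => p.1.1) (fun p => p.2)
      (compRel_intro F G (fun p => p.1.2) (T.inf_right (T.inf_left h')) (T.inf_right h'))

theorem comp_congr {F F' : FuncRel A B} {G G' : FuncRel B C} (e : F ≈ F') (e' : G ≈ G') :
    comp F G ≈ comp F' G' := by
  constructor
  · refine compRel_elim F G (x := fun p : A.X × C.X => p.1) (z := fun p => p.2)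
      (P.le_refl _) ?_
    intro δ _ h1 h2
    exact compRel_intro F' G' (fun p => p.2) (le_of_equiv e h1) (le_of_equiv e' h2)
  · refine compRel_elim F' G' (x := fun p : A.X × C.X => p.1) (z := fun p => p.2)
      (P.le_refl _) ?_
    intro δ _ h1 h2
    exact compRel_intro F G (fun p => p.2) (le_of_equiv (Setoid.symm e) h1)
      (le_of_equiv (Setoid.symm e') h2)

theorem id_comp (F : FuncRel A B) : comp (id A) F ≈ F := by
  constructor
  · refine compRel_elim (id A) F (x := fun p : A.X × B.X => p.1) (z := fun p => p.2)
      (P.le_refl _) ?_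
    intro δ _ h1 h2
    exact F.congr' h2 (A.symm' h1) (F.right h2)
  · have h := P.le_refl (fun p : A.X × B.X => F.rel p.1 p.2)
    exact compRel_intro (id A) F (fun p => p.1) (F.left h) h

theorem comp_id (F : FuncRel A B) : comp F (id B) ≈ F := by
  constructor
  · refine compRel_elim F (id B) (x := fun p : A.X × B.X => p.1) (z := fun p => p.2)
      (P.le_refl _) ?_
    intro δ _ h1 h2
    exact F.congr' h1 (F.left h1) h2
  · have h := P.le_refl (fun p : A.X × B.X => F.rel p.1 p.2)
    exact compRel_intro F (id B) (fun p => p.2) h (F.right h)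

theorem assoc (F : FuncRel A B) (G : FuncRel B C) (H : FuncRel C D) :
    comp (comp F G) H ≈ comp F (comp G H) := by
  constructor
  · refine compRel_elim (comp F G) H (x := fun p : A.X × D.X => p.1) (z := fun p => p.2)
      (P.le_refl _) ?_
    intro δ _ h1 h2
    refine compRel_elim F G (x := fun p : (A.X × D.X) × C.X => p.1.1) (z := fun p => p.2)
      h1 ?_
    intro ε h h3 h4
    have h2' := P.le_trans h (P.le_reindex Prod.fst h2)
    exact compRel_intro F (comp G H) (fun p => p.2) h3
      (compRel_intro G H (fun p => p.1.2) h4 h2')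
  · refine compRel_elim F (comp G H) (x := fun p : A.X × D.X => p.1) (z := fun p => p.2)
      (P.le_refl _) ?_
    intro δ _ h1 h2
    refine compRel_elim G H (x := fun p : (A.X × D.X) × B.X => p.2) (z := fun p => p.1.2)
      h2 ?_
    intro ε h h3 h4
    have h1' := P.le_trans h (P.le_reindex Prod.fst h1)
    exact compRel_intro (comp F G) H (fun p => p.2)
      (compRel_intro F G (fun p => p.1.2) h1' h3) h4

end FuncRel

/-- The topos represented by a tripos: its morphisms are the isomorphism classes of functional
relations. -/
instance category : Category.{u} (Obj T) where
  Hom A B := Quotient (FuncRel.setoid A B)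
  id A := Quotient.mk _ (FuncRel.id A)
  comp := Quotient.map₂ FuncRel.comp (fun _ _ e _ _ e' => FuncRel.comp_congr e e')
  id_comp := by
    rintro A B ⟨F⟩
    exact Quotient.sound (FuncRel.id_comp F)
  comp_id := by
    rintro A B ⟨F⟩
    exact Quotient.sound (FuncRel.comp_id F)
  assoc := by
    rintro A B C D ⟨F⟩ ⟨G⟩ ⟨H⟩
    exact Quotient.sound (FuncRel.assoc F G H)

/-- The subterminal object of the topos given by a truth value `v`: a one-point set, the point
of which exists to the extent `v`. -/
def subterminal (T : P.Tripos) (v : P.Val) : Obj T where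
  X := PUnit
  eq _ _ := v
  symm := P.le_refl _
  trans := T.inf_left (P.le_refl _)

end Tripos

end IndexedPreorder

/-! ### Closed subtoposes and Booleanizations -/

section Subtoposes

universe v w

variable {C : Type w} [Category.{v} C]

/-- For a subterminal object `U` of a topos, the closed subtopos complementary to `U` consists of
the objects `F` such that the projection `F × U ⟶ U` is an isomorphism; that is, such that every
object over `U` has exactly one morphism to `F`. -/
def closedSubtopos (U : C) : ObjectProperty C := fun F =>
  ∀ X : C, Nonempty (X ⟶ U) → ∃! _f : X ⟶ F, True

/-- The monomorphisms `m : A ⟶ B` which are dense for double negation: the only subobject of `B`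
which is disjoint from `A` is the initial one. -/
def doubleNegDense (C : Type w) [Category.{v} C] : MorphismProperty C := fun A B m =>
  Mono m ∧ ∀ (S : C) (s : S ⟶ B), Mono s →
    (∀ (X : C) (p : X ⟶ S) (q : X ⟶ A), p ≫ s = q ≫ m → Nonempty (Limits.IsInitial X)) →
    Nonempty (Limits.IsInitial S)

/-- The Booleanization of a topos: the full subcategory of sheaves for double negation, which are
the objects `F` such that every morphism to `F` from the domain of a dense monomorphism extends
uniquely to its codomain. -/
abbrev Booleanization (C : Type w) [Category.{v} C] : Type w :=
  (doubleNegDense C).isLocal.FullSubcategory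

end Subtoposes

/-! ### Basic combinatorial objects -/

/-- Basic combinatorial objects. -/
structure BCO where
  carrier : Type u
  [order : PartialOrder carrier]
  maps : Set (carrier →. carrier)
  mono : ∀ f ∈ maps, ∀ a b a' : carrier, b ∈ f a → a' ≤ a → ∃ b' ∈ f a', b' ≤ b
  id_mem : ∃ i ∈ maps, ∀ a : carrier, ∃ b ∈ i a, b ≤ a
  comp_mem : ∀ f ∈ maps, ∀ g ∈ maps, ∃ h ∈ maps, ∀ a b c : carrier,
    b ∈ f a → c ∈ g b → ∃ d ∈ h a, d ≤ c

attribute [instance] BCO.order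

namespace BCO

/-- The Set-indexed preorder `[-, Σ]` of a BCO. -/
def indexed (Sg : BCO.{u}) : IndexedPreorder.{u} where
  Val := Sg.carrier
  le {_} φ ψ := ∃ f ∈ Sg.maps, ∀ x, ∃ b ∈ f (φ x), b ≤ ψ x
  le_refl φ := by
    obtain ⟨i, hi, h⟩ := Sg.id_mem
    exact ⟨i, hi, fun x => h (φ x)⟩
  le_trans := by
    rintro I φ ψ χ ⟨f, hf, h⟩ ⟨g, hg, h'⟩
    obtain ⟨k, hk, hc⟩ := Sg.comp_mem f hf g hg
    refine ⟨k, hk, fun x => ?_⟩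
    obtain ⟨b, hb, hb'⟩ := h x
    obtain ⟨c, hc1, hc2⟩ := h' x
    obtain ⟨d, hd, hd'⟩ := Sg.mono g hg _ _ _ hc1 hb'
    obtain ⟨e, he, he'⟩ := hc _ _ _ hb hd
    exact ⟨e, he, he'.trans (hd'.trans hc2)⟩
  le_reindex := by
    rintro I J r φ ψ ⟨f, hf, h⟩
    exact ⟨f, hf, fun j => h (r j)⟩

/-- The partial map on downsets induced by a partial map `f`: it is defined on the downsets which
are contained in the domain of `f`, and there it is the downwards closure of the image. -/
def downMap {S : Type u} [PartialOrder S] (f : S →. S) : LowerSet S →. LowerSet S :=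
  fun V => ⟨∀ a ∈ V, (f a).Dom, fun _ => lowerClosure {b | ∃ a ∈ V, b ∈ f a}⟩

theorem mem_downMap {S : Type u} [PartialOrder S] {f : S →. S} {V W : LowerSet S} :
    W ∈ downMap f V ↔ (∀ a ∈ V, (f a).Dom) ∧ lowerClosure {b | ∃ a ∈ V, b ∈ f a} = W :=
  ⟨fun ⟨h, e⟩ => ⟨h, e⟩, fun ⟨h, e⟩ => ⟨h, e⟩⟩

/-- The downset monad `D` on objects. Downsets are ordered by inclusion. -/
def down (Sg : BCO.{u}) : BCO.{u} where
  carrier := LowerSet Sg.carrier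
  maps := {F | ∃ f ∈ Sg.maps, F = downMap f}
  mono := by
    rintro _ ⟨f, hf, rfl⟩ V W V' hW hV
    rw [mem_downMap] at hW
    obtain ⟨hd, rfl⟩ := hW
    refine ⟨_, mem_downMap.2 ⟨fun a ha => hd a (hV ha), rfl⟩, ?_⟩
    rw [lowerClosure_le]
    rintro b ⟨a, ha, hb⟩
    exact subset_lowerClosure ⟨a, hV ha, hb⟩
  id_mem := by
    obtain ⟨i, hi, h⟩ := Sg.id_mem
    refine ⟨_, ⟨i, hi, rfl⟩, fun V => ⟨_, mem_downMap.2 ⟨fun a _ => ?_, rfl⟩, ?_⟩⟩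
    · obtain ⟨b, hb, _⟩ := h a
      exact Part.dom_iff_mem.2 ⟨b, hb⟩
    · rw [lowerClosure_le]
      rintro b ⟨a, ha, hb⟩
      obtain ⟨b', hb', hle⟩ := h a
      rw [Part.mem_unique hb hb']
      exact V.lower hle ha
  comp_mem := by
    rintro _ ⟨f, hf, rfl⟩ _ ⟨g, hg, rfl⟩
    obtain ⟨k, hk, hc⟩ := Sg.comp_mem f hf g hg
    refine ⟨_, ⟨k, hk, rfl⟩, ?_⟩
    intro V W W' hW hW'
    rw [mem_downMap] at hW hW'
    obtain ⟨hd, rfl⟩ := hW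
    obtain ⟨hd', rfl⟩ := hW'
    have key : ∀ a ∈ V, ∃ b ∈ f a, ∃ c ∈ g b, ∃ d ∈ k a, d ≤ c := by
      intro a ha
      obtain ⟨b, hb⟩ := Part.dom_iff_mem.1 (hd a ha)
      obtain ⟨c, hc1⟩ := Part.dom_iff_mem.1 (hd' b (subset_lowerClosure ⟨a, ha, hb⟩))
      obtain ⟨d, hd1, hd2⟩ := hc a b c hb hc1
      exact ⟨b, hb, c, hc1, d, hd1, hd2⟩
    refine ⟨_, mem_downMap.2 ⟨fun a ha => ?_, rfl⟩, ?_⟩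
    · obtain ⟨_, _, _, _, d, hd1, _⟩ := key a ha
      exact Part.dom_iff_mem.2 ⟨d, hd1⟩
    · rw [lowerClosure_le]
      rintro d ⟨a, ha, hd1⟩
      obtain ⟨b, hb, c, hc1, d', hd2, hle⟩ := key a ha
      rw [Part.mem_unique hd1 hd2]
      exact LowerSet.lower _ hle
        (subset_lowerClosure ⟨b, subset_lowerClosure ⟨a, ha, hb⟩, hc1⟩)

end BCO

/-! ### Filtered opcas -/

/-- The property of the combinator `k`: for all `x, y`, `(k x) y` is defined and `≤ x`. -/
def IsK {A : Type u} [PartialOrder A] (app : A → A → Part A) (k : A) : Prop :=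
  ∀ x y : A, ∃ kx ∈ app k x, ∃ r ∈ app kx y, r ≤ x

/-- The property of the combinator `s`: whenever `(x z) (y z)` is defined, then `((s x) y) z` is
defined and `((s x) y) z ≤ (x z) (y z)`. -/
def IsS {A : Type u} [PartialOrder A] (app : A → A → Part A) (s : A) : Prop :=
  ∀ x y z xz yz r : A, xz ∈ app x z → yz ∈ app y z → r ∈ app xz yz →
    ∃ sx ∈ app s x, ∃ sxy ∈ app sx y, ∃ r' ∈ app sxy z, r' ≤ r

/-- Filtered opcas `(A, A')`: an order-pca with a subset `A'` (the filter) which is closed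
under application and contains choices for `k` and `s`. -/
structure FilteredOPCA where
  carrier : Type u
  [order : PartialOrder carrier]
  app : carrier → carrier → Part carrier
  app_mono : ∀ a b r a' b' : carrier, r ∈ app a b → a' ≤ a → b' ≤ b →
    ∃ r' ∈ app a' b', r' ≤ r
  filter : Set carrier
  app_mem : ∀ a ∈ filter, ∀ b ∈ filter, ∀ r ∈ app a b, r ∈ filter
  exists_k : ∃ k ∈ filter, IsK app k
  exists_s : ∃ s ∈ filter, IsS app s

attribute [instance] FilteredOPCA.order

namespace FilteredOPCA

/-- A filtered opca as a BCO: the maps are `b ↦ a b` for `a` in the filter. -/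
def toBCO (A : FilteredOPCA.{u}) : BCO.{u} where
  carrier := A.carrier
  maps := {f | ∃ a ∈ A.filter, f = A.app a}
  mono := by
    rintro _ ⟨c, hc, rfl⟩ a b a' hb ha
    exact A.app_mono c a b c a' hb le_rfl ha
  id_mem := by
    obtain ⟨k, hk, hK⟩ := A.exists_k
    obtain ⟨s, hs, hS⟩ := A.exists_s
    have key : ∀ z, ∃ sk ∈ A.app s k, ∃ skk ∈ A.app sk k, ∃ r ∈ A.app skk z, r ≤ z := by
      intro z
      obtain ⟨kz, hkz, -⟩ := hK z z
      obtain ⟨kz', hkz', r, hr, hle⟩ := hK z kz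
      rw [Part.mem_unique hkz' hkz] at hr
      obtain ⟨sk, hsk, skk, hskk, r', hr', hle'⟩ := hS k k z kz kz r hkz hkz hr
      exact ⟨sk, hsk, skk, hskk, r', hr', hle'.trans hle⟩
    obtain ⟨sk, hsk, skk, hskk, -⟩ := key k
    refine ⟨_, ⟨skk, A.app_mem _ (A.app_mem _ hs _ hk _ hsk) _ hk _ hskk, rfl⟩, fun z => ?_⟩
    obtain ⟨sk', hsk', skk', hskk', r, hr, hle⟩ := key z
    rw [Part.mem_unique hsk' hsk] at hskk'
    rw [Part.mem_unique hskk' hskk] at hr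
    exact ⟨r, hr, hle⟩
  comp_mem := by
    rintro _ ⟨f, hf, rfl⟩ _ ⟨g, hg, rfl⟩
    obtain ⟨k, hk, hK⟩ := A.exists_k
    obtain ⟨s, hs, hS⟩ := A.exists_s
    obtain ⟨kg, hkg, -⟩ := hK g g
    have key : ∀ a b c, b ∈ A.app f a → c ∈ A.app g b →
        ∃ sk ∈ A.app s kg, ∃ t ∈ A.app sk f, ∃ r ∈ A.app t a, r ≤ c := by
      intro a b c hb hc
      obtain ⟨kg', hkg', g', hg', hle⟩ := hK g a
      rw [Part.mem_unique hkg' hkg] at hg'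
      obtain ⟨c', hc', hle'⟩ := A.app_mono g b c g' b hc hle le_rfl
      obtain ⟨sk, hsk, t, ht, r, hr, hr'⟩ := hS kg f a g' b c' hg' hb hc'
      exact ⟨sk, hsk, t, ht, r, hr, hr'.trans hle'⟩
    by_cases hex : ∃ a b c, b ∈ A.app f a ∧ c ∈ A.app g b
    · obtain ⟨a₀, b₀, c₀, hb₀, hc₀⟩ := hex
      obtain ⟨sk, hsk, t, ht, -⟩ := key a₀ b₀ c₀ hb₀ hc₀
      refine ⟨_, ⟨t, A.app_mem _ (A.app_mem _ hs _ (A.app_mem _ hk _ hg _ hkg) _ hsk) _ hf _ ht,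
        rfl⟩, fun a b c hb hc => ?_⟩
      obtain ⟨sk', hsk', t', ht', r, hr, hle⟩ := key a b c hb hc
      rw [Part.mem_unique hsk' hsk] at ht'
      rw [Part.mem_unique ht' ht] at hr
      exact ⟨r, hr, hle⟩
    · exact ⟨_, ⟨f, hf, rfl⟩, fun a b c hb hc => (hex ⟨a, b, c, hb, hc⟩).elim⟩

/-- The Set-indexed preorder `[-, D(A, A')]`. -/
abbrev downIndexed (A : FilteredOPCA.{u}) : IndexedPreorder.{u} := A.toBCO.down.indexed

/-- The downset `α → U`, consisting of those `a` such that for all `b ∈ α`, `a b` is defined and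
in `U`. -/
def imp (A : FilteredOPCA.{u}) (α U : LowerSet A.carrier) : LowerSet A.carrier where
  carrier := {a | ∀ b ∈ α, ∃ r ∈ A.app a b, r ∈ U}
  lower' := by
    intro a a' hle ha b hb
    obtain ⟨r, hr, hU⟩ := ha b hb
    obtain ⟨r', hr', hle'⟩ := A.app_mono a b r a' b hr hle le_rfl
    exact ⟨r', hr', U.lower hle' hU⟩

/-- The Booleanization of `[-, D(A, A')]` with respect to a downset `U`: the predicates on `I` are
all functions `I → D A`, and `φ ≤ ψ` if and only if `(ψ → U) ≤ (φ → U)` in `[I, D(A, A')]`. -/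
def booleanization (A : FilteredOPCA.{u}) (U : LowerSet A.carrier) : IndexedPreorder.{u} where
  Val := LowerSet A.carrier
  le {_} φ ψ := A.downIndexed.le (fun i => A.imp (ψ i) U) (fun i => A.imp (φ i) U)
  le_refl _ := A.downIndexed.le_refl _
  le_trans h h' := A.downIndexed.le_trans h' h
  le_reindex f _ _ h := A.downIndexed.le_reindex f h

end FilteredOPCA

/-! ### Abstract Krivine structures -/

/-- Abstract Krivine structures. -/
structure AKS where
  Term : Type u
  app : Term → Term → Term
  K : Term
  S : Term
  cc : Term
  QP : Set Term
  K_mem : K ∈ QP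
  S_mem : S ∈ QP
  cc_mem : cc ∈ QP
  app_mem : ∀ t ∈ QP, ∀ s ∈ QP, app t s ∈ QP
  Stack : Type u
  push : Term → Stack → Stack
  k : Stack → Term
  pole : Set (Term × Stack)
  pole_app : ∀ t s π, (t, push s π) ∈ pole → (app t s, π) ∈ pole
  pole_K : ∀ t s π, (t, π) ∈ pole → (K, push t (push s π)) ∈ pole
  pole_S : ∀ t s u π, (app (app t u) (app s u), π) ∈ pole →
    (S, push t (push s (push u π))) ∈ pole
  pole_cc : ∀ t π, (t, push (k π) π) ∈ pole → (cc, push t π) ∈ pole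
  pole_k : ∀ t π π', (t, π) ∈ pole → (k π, push t π') ∈ pole

namespace AKS

variable (𝒦 : AKS.{u})

/-- The stacks orthogonal to all terms in a given set. -/
def orthStacks (X : Set 𝒦.Term) : Set 𝒦.Stack := {π | ∀ t ∈ X, (t, π) ∈ 𝒦.pole}

/-- The set `|α|` of terms orthogonal to all stacks in `α`. -/
def orthTerms (α : Set 𝒦.Stack) : Set 𝒦.Term := {t | ∀ π ∈ α, (t, π) ∈ 𝒦.pole}

/-- An abstract Krivine structure is nondegenerate if no quasi-proof is orthogonal to all
stacks. -/
def Nondegenerate : Prop := ∀ t ∈ 𝒦.QP, ∃ π, (t, π) ∉ 𝒦.pole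

/-- The biorthogonally closed sets of stacks. -/
@[ext]
structure ClosedSet where
  carrier : Set 𝒦.Stack
  closed : 𝒦.orthStacks (𝒦.orthTerms carrier) = carrier

/-- Closed sets of stacks are ordered by reverse inclusion. -/
instance : PartialOrder 𝒦.ClosedSet where
  le α β := β.carrier ⊆ α.carrier
  le_refl _ := subset_rfl
  le_trans _ _ _ h h' := h'.trans h
  le_antisymm _ _ h h' := ClosedSet.ext (h'.antisymm h)

variable {𝒦}

theorem orthTerms_orthStacks_orthTerms (α : Set 𝒦.Stack) :
    𝒦.orthTerms (𝒦.orthStacks (𝒦.orthTerms α)) = 𝒦.orthTerms α :=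
  Set.Subset.antisymm (fun _ ht π hπ => ht π (fun _ ht' => ht' π hπ))
    (fun t ht _ hπ => hπ t ht)

/-- The biorthogonal closure of a set of stacks. -/
def closure (α : Set 𝒦.Stack) : 𝒦.ClosedSet where
  carrier := 𝒦.orthStacks (𝒦.orthTerms α)
  closed := by rw [orthTerms_orthStacks_orthTerms]

theorem subset_closure (α : Set 𝒦.Stack) : α ⊆ (closure α).carrier :=
  fun π hπ _ ht => ht π hπ

theorem closure_subset {α : Set 𝒦.Stack} {β : 𝒦.ClosedSet} (h : α ⊆ β.carrier) :
    (closure α).carrier ⊆ β.carrier := by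
  intro π hπ
  rw [← β.closed]
  exact fun t ht => hπ t (fun π' hπ' => ht π' (h hπ'))

/-- The closed set of stacks orthogonal to a term. -/
def ofTerm (t : 𝒦.Term) : 𝒦.ClosedSet where
  carrier := 𝒦.orthStacks {t}
  closed := by
    refine Set.Subset.antisymm (fun π hπ t' ht' => ?_) (fun π hπ _ ht' => ht' π hπ)
    obtain rfl : t' = t := ht'
    exact hπ _ (fun π' hπ' => hπ' _ rfl)

theorem mem_ofTerm {t : 𝒦.Term} {π : 𝒦.Stack} : π ∈ (ofTerm t).carrier ↔ (t, π) ∈ 𝒦.pole :=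
  ⟨fun h => h t rfl, fun h t' ht' => by obtain rfl : t' = t := ht'; exact h⟩

/-- The set of stacks whose closure is `α • β`. -/
def preBullet (α β : 𝒦.ClosedSet) : Set 𝒦.Stack :=
  {π | ∀ t ∈ 𝒦.orthTerms α.carrier, ∀ s ∈ 𝒦.orthTerms β.carrier, (t, 𝒦.push s π) ∈ 𝒦.pole}

/-- The application `α • β` on closed sets of stacks. -/
def bullet (α β : 𝒦.ClosedSet) : 𝒦.ClosedSet := closure (preBullet α β)

theorem app_mem_bullet {α β : 𝒦.ClosedSet} {t s : 𝒦.Term}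
    (ht : t ∈ 𝒦.orthTerms α.carrier) (hs : s ∈ 𝒦.orthTerms β.carrier) :
    𝒦.app t s ∈ 𝒦.orthTerms (bullet α β).carrier := by
  have h : 𝒦.app t s ∈ 𝒦.orthTerms (preBullet α β) :=
    fun π hπ => 𝒦.pole_app _ _ _ (hπ t ht s hs)
  exact fun π hπ => hπ _ h

theorem bullet_mono {α β α' β' : 𝒦.ClosedSet} (h : α' ≤ α) (h' : β' ≤ β) :
    bullet α' β' ≤ bullet α β := by
  refine closure_subset (fun π hπ => subset_closure _ ?_)
  exact fun t ht s hs => hπ t (fun ρ hρ => ht ρ (h hρ)) s (fun ρ hρ => hs ρ (h' hρ))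

theorem mem_bullet {α β : 𝒦.ClosedSet} {π : 𝒦.Stack}
    (h : ∀ s ∈ 𝒦.orthTerms β.carrier, 𝒦.push s π ∈ α.carrier) : π ∈ (bullet α β).carrier :=
  subset_closure _ (fun _ ht s hs => ht _ (h s hs))

theorem isK_ofTerm : IsK (fun α β : 𝒦.ClosedSet => Part.some (bullet α β)) (ofTerm 𝒦.K) := by
  intro α β
  refine ⟨_, Part.mem_some _, _, Part.mem_some _, ?_⟩
  intro π hπ
  exact mem_bullet (fun s _ => mem_bullet (fun t ht =>
    mem_ofTerm.2 (𝒦.pole_K _ _ _ (ht π hπ))))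

theorem isS_ofTerm : IsS (fun α β : 𝒦.ClosedSet => Part.some (bullet α β)) (ofTerm 𝒦.S) := by
  intro α β γ αγ βγ δ h₁ h₂ h₃
  obtain rfl := Part.mem_some_iff.1 h₁
  obtain rfl := Part.mem_some_iff.1 h₂
  obtain rfl := Part.mem_some_iff.1 h₃
  refine ⟨_, Part.mem_some _, _, Part.mem_some _, _, Part.mem_some _, ?_⟩
  intro π hπ
  exact mem_bullet (fun w hw => mem_bullet (fun v hv => mem_bullet (fun u hu =>
    mem_ofTerm.2 (𝒦.pole_S _ _ _ _
      (app_mem_bullet (app_mem_bullet hu hw) (app_mem_bullet hv hw) π hπ)))))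

theorem mem_orthTerms_ofTerm (t : 𝒦.Term) : t ∈ 𝒦.orthTerms (ofTerm t).carrier :=
  fun _ hπ => mem_ofTerm.1 hπ

variable (𝒦)

/-- The filtered opca of closed sets of stacks constructed from an abstract Krivine structure; the
filter consists of the `α` such that `|α|` contains a quasi-proof. -/
def filteredOPCA : FilteredOPCA.{u} where
  carrier := 𝒦.ClosedSet
  app α β := Part.some (bullet α β)
  app_mono := by
    intro α β δ α' β' h hα hβ
    obtain rfl := Part.mem_some_iff.1 h
    exact ⟨_, Part.mem_some _, bullet_mono hα hβ⟩
  filter := {α | (𝒦.orthTerms α.carrier ∩ 𝒦.QP).Nonempty}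
  app_mem := by
    rintro α ⟨t, ht, ht'⟩ β ⟨s, hs, hs'⟩ δ h
    obtain rfl := Part.mem_some_iff.1 h
    exact ⟨𝒦.app t s, app_mem_bullet ht hs, 𝒦.app_mem _ ht' _ hs'⟩
  exists_k := ⟨ofTerm 𝒦.K, ⟨𝒦.K, mem_orthTerms_ofTerm _, 𝒦.K_mem⟩, isK_ofTerm⟩
  exists_s := ⟨ofTerm 𝒦.S, ⟨𝒦.S, mem_orthTerms_ofTerm _, 𝒦.S_mem⟩, isS_ofTerm⟩

/-- The Krivine tripos arising from an abstract Krivine structure. -/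
abbrev krivineTripos : IndexedPreorder.{u} := 𝒦.filteredOPCA.toBCO.indexed

end AKS

end KrivineTripos

/-! The witnesses are `(A, A')` = the opca of closed sets of stacks with its own filter, and `U` =
the principal downset of the least element `⊥`, the set of all stacks. A term in `|⊥|` is orthogonal
to every stack, so nondegeneracy says exactly that `⊥` is not in the filter.

A truth value `α` becomes the downset `principal α`. Conversely a downset `V` becomes `join V`, the
implication from the infimum of all negations `b → ⊥`, `b ∈ V`, to `⊥`. Since realizers can be
chosen independently of `b` and `V`, `join` is left adjoint to `principal` (`join_entails_iff`);
this is where `cc` is needed, to remove a double negation. Moreover `principal (join V)` is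
isomorphic to `(V → U) → U` (`join_entails_nn`, `nn_entails_join`). Thus Krivine's preorder is the
reflective part of the tripos of downsets cut out by double negation relative to `U`. As `(ψ → U) ≤
(φ → U)` amounts to `φ ≤ ((ψ → U) → U)`, hence to `join φ ≤ join ψ`, it is also the Booleanization.

The statement on toposes holds for every such reflection (`NegNegReflection`). An object lies in the
closed subtopos complementary to `u` iff it has exactly one element to the extent `u`
(`closedSubtopos_iff`). The subterminal object `u` is then initial there
(`ClosedSub.isInitial_iff`), so that negation in the closed subtopos is implication into `u`. The
left adjoint of the reflection preserves finite meets and existential quantification, so it acts on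
objects and functional relations, and it inverts the dense monomorphisms. On sheaves this functor is
faithful, since sheaves are separated; full, since a relation in the target has honest values on a
dense subobject, from which it extends; and essentially surjective, since every `Y` is the image of
its object of singletons (`isLocal_singletons`). -/

namespace KrivineTripos

namespace IndexedPreorder

/-- Weakening of an entailment along a change of context. -/
theorem weaken (P : IndexedPreorder.{u}) {J K : Type u} (f : J → K) {γ φ : K → P.Val}
    {δ : J → P.Val} (hδ : P.le δ (fun j => γ (f j))) (h : P.le γ φ) :
    P.le δ (fun j => φ (f j)) :=
  P.le_trans hδ (P.le_reindex f h)

namespace Tripos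

/-! ### Natural deduction in the internal logic of a tripos -/

section Logic

variable {P : IndexedPreorder.{u}} (T : P.Tripos)

/-- The extended context is an arbitrary `δ` rather than an explicit conjunction, so that each
hypothesis can be weakened to `δ` separately. `himp_intro` and `nn_cases` have the same form. -/
theorem some_cases {I Y K : Type u} {φ : I → Y → P.Val} {g : K → I} {γ χ : K → P.Val}
    (h : P.le γ (fun k => T.some φ (g k)))
    (h' : ∀ δ : K × Y → P.Val, P.le δ (fun p => γ p.1) →
      P.le δ (fun p => φ (g p.1) p.2) → P.le δ (fun p => χ p.1)) : P.le γ χ :=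
  T.some_elim h (h' _ (T.inf_left (P.le_refl _)) (T.inf_right (P.le_refl _)))

theorem himp_intro {K : Type u} {γ φ ψ : K → P.Val}
    (h : ∀ δ : K → P.Val, P.le δ γ → P.le δ φ → P.le δ ψ) :
    P.le γ (fun k => T.himp (φ k) (ψ k)) :=
  (T.le_himp_iff _ _ _).2 (h _ (T.inf_left (P.le_refl _)) (T.inf_right (P.le_refl _)))

theorem himp_elim {K : Type u} {γ φ ψ : K → P.Val}
    (h : P.le γ (fun k => T.himp (φ k) (ψ k))) (h' : P.le γ φ) : P.le γ ψ :=
  P.le_trans (T.inf_intro (P.le_refl γ) h') ((T.le_himp_iff _ _ _).1 h)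

/-- Universal quantification over a variable ranging over the set `Y`. -/
def every {I Y : Type u} (φ : I → Y → P.Val) : I → P.Val :=
  T.all (fun p : I × Y => p.1) (fun p => φ p.1 p.2)

theorem every_intro {I Y K : Type u} {φ : I → Y → P.Val} {g : K → I} {γ : K → P.Val}
    (h : P.le (fun p : K × Y => γ p.1) (fun p => φ (g p.1) p.2)) :
    P.le γ (fun k => T.every φ (g k)) := by
  refine P.le_trans ?_ (T.all_beckChevalley (fun p : I × Y => p.1) g (fun p => φ p.1 p.2)).2
  rw [T.le_all_iff]
  have h1 := P.le_reindex
    (fun p : {p : K × (I × Y) // g p.1 = p.2.1} => (p.1.1, p.1.2.2)) h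
  -- On the pullback the variable of `I` equals `g` of the variable of `K`.
  have e : (fun p : {p : K × (I × Y) // g p.1 = p.2.1} => φ p.1.2.1 p.1.2.2)
      = fun p => φ (g p.1.1) p.1.2.2 := by
    funext p; rw [p.2]
  rw [e]
  exact h1

theorem every_elim {I Y K : Type u} {φ : I → Y → P.Val} {g : K → I} {γ : K → P.Val}
    (h : P.le γ (fun k => T.every φ (g k))) (y : K → Y) :
    P.le γ (fun k => φ (g k) (y k)) := by
  have h0 : P.le (fun p : I × Y => T.every φ p.1) (fun p => φ p.1 p.2) :=
    (T.le_all_iff (fun p : I × Y => p.1) (fun p => φ p.1 p.2) (T.every φ)).1 (P.le_refl _)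
  exact P.le_trans h (P.le_reindex (fun k => (g k, y k)) h0)

/-- Double negation relative to the truth value `u`. -/
def nn (u v : P.Val) : P.Val := T.himp (T.himp v u) u

variable {u : P.Val} {K : Type u}

theorem nn_intro {γ φ : K → P.Val} (h : P.le γ φ) : P.le γ (fun k => T.nn u (φ k)) :=
  T.himp_intro (fun _ h1 h2 => T.himp_elim h2 (P.le_trans h1 h))

theorem nn_of_bot {γ φ : K → P.Val} (h : P.le γ (fun _ => u)) :
    P.le γ (fun k => T.nn u (φ k)) :=
  T.himp_intro (fun _ h1 _ => P.le_trans h1 h)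

/-- The bind of the monad `nn u`: as long as the goal is doubly negated, a doubly negated hypothesis
may be used as if it held. -/
theorem nn_cases {γ φ ψ : K → P.Val} (h : P.le γ (fun k => T.nn u (φ k)))
    (h' : ∀ δ : K → P.Val, P.le δ γ → P.le δ φ → P.le δ (fun k => T.nn u (ψ k))) :
    P.le γ (fun k => T.nn u (ψ k)) :=
  T.himp_intro (fun _ h1 h2 => T.himp_elim (P.le_trans h1 h)
    (T.himp_intro (fun _ h3 h4 => T.himp_elim (h' _ (P.le_trans h3 h1) h4)
      (P.le_trans h3 h2))))

end Logic

/-! ### Functional relations and morphisms -/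

section Morphisms

variable {P : IndexedPreorder.{u}} {T : P.Tripos} {A B C : Obj T}

theorem Obj.refl_left (A : Obj T) {K : Type u} {γ : K → P.Val} {x y : K → A.X}
    (h : P.le γ (fun k => A.eq (x k) (y k))) : P.le γ (fun k => A.eq (x k) (x k)) :=
  A.trans' h (A.symm' h)

theorem Obj.refl_right (A : Obj T) {K : Type u} {γ : K → P.Val} {x y : K → A.X}
    (h : P.le γ (fun k => A.eq (x k) (y k))) : P.le γ (fun k => A.eq (y k) (y k)) :=
  A.trans' (A.symm' h) h

/-- The morphism represented by a functional relation. -/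
def FuncRel.hom (F : FuncRel A B) : A ⟶ B := Quotient.mk _ F

theorem FuncRel.exists_hom (f : A ⟶ B) : ∃ F : FuncRel A B, F.hom = f :=
  Quotient.exists_rep f

theorem FuncRel.comp_hom (F : FuncRel A B) (G : FuncRel B C) :
    F.hom ≫ G.hom = (FuncRel.comp F G).hom := rfl

theorem FuncRel.id_hom : (FuncRel.id A).hom = 𝟙 A := rfl

theorem FuncRel.hom_eq_iff {F G : FuncRel A B} : F.hom = G.hom ↔ F ≈ G :=
  ⟨fun h => Quotient.exact h, fun h => Quotient.sound h⟩

/-- If `G x y`, totality of `F` gives `y'` with `F x y'`, hence `G x y'`; then `y' = y` because `G`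
is single-valued, and so `F x y`. Equalities of morphisms therefore need one inclusion only. -/
theorem FuncRel.equiv_of_le {F G : FuncRel A B}
    (h : P.le (fun p : A.X × B.X => F.rel p.1 p.2) (fun p => G.rel p.1 p.2)) : F ≈ G := by
  refine ⟨h, ?_⟩
  have h0 := P.le_refl (fun p : A.X × B.X => G.rel p.1 p.2)
  refine T.some_cases (φ := F.rel) (g := fun p : A.X × B.X => p.1) (F.total' (G.left h0)) ?_
  intro δ h1 h2
  have h3 := P.le_trans h2 (P.le_reindex (fun p : (A.X × B.X) × B.X => (p.1.1, p.2)) h)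
  have h4 : P.le δ (fun p => G.rel p.1.1 p.1.2) := h1
  exact F.congr' h2 (F.left h2) (G.single' h3 h4)

theorem FuncRel.hom_eq_of_le {F G : FuncRel A B}
    (h : P.le (fun p : A.X × B.X => F.rel p.1 p.2) (fun p => G.rel p.1 p.2)) :
    F.hom = G.hom :=
  FuncRel.hom_eq_iff.2 (FuncRel.equiv_of_le h)

/-- The opposite of an injective and surjective functional relation. -/
def FuncRel.op (F : FuncRel A B)
    (inj : P.le (fun p : A.X × A.X × B.X => T.inf (F.rel p.1 p.2.2) (F.rel p.2.1 p.2.2))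
      (fun p => A.eq p.1 p.2.1))
    (surj : P.le (fun y : B.X => B.eq y y)
      (T.some (fun (y : B.X) (x : A.X) => F.rel x y))) : FuncRel B A where
  rel y x := F.rel x y
  strict := by
    have h := P.le_refl (fun p : B.X × A.X => F.rel p.2 p.1)
    exact T.inf_intro (F.right h) (F.left h)
  congr := by
    have h := P.le_refl (fun p : (B.X × B.X) × (A.X × A.X) =>
      T.inf (F.rel p.2.1 p.1.1) (T.inf (B.eq p.1.1 p.1.2) (A.eq p.2.1 p.2.2)))
    exact F.congr' (T.inf_left h) (T.inf_right (T.inf_right h)) (T.inf_left (T.inf_right h))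
  single := by
    have h := P.le_refl (fun p : B.X × A.X × A.X =>
      T.inf (F.rel p.2.1 p.1) (F.rel p.2.2 p.1))
    exact P.le_trans h (P.le_reindex (fun p : B.X × A.X × A.X => (p.2.1, p.2.2, p.1)) inj)
  total := surj

theorem FuncRel.isIso_hom (F : FuncRel A B)
    (inj : P.le (fun p : A.X × A.X × B.X => T.inf (F.rel p.1 p.2.2) (F.rel p.2.1 p.2.2))
      (fun p => A.eq p.1 p.2.1))
    (surj : P.le (fun y : B.X => B.eq y y)
      (T.some (fun (y : B.X) (x : A.X) => F.rel x y))) : IsIso F.hom := by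
  refine ⟨(F.op inj surj).hom, ?_, ?_⟩
  · rw [comp_hom, ← id_hom]
    refine hom_eq_of_le ?_
    refine compRel_elim F (F.op inj surj) (x := fun p : A.X × A.X => p.1) (z := fun p => p.2)
      (P.le_refl _) ?_
    intro δ _ h1 h2
    exact P.le_trans (T.inf_intro h1 h2)
      (P.le_reindex (fun p : (A.X × A.X) × B.X => (p.1.1, p.1.2, p.2)) inj)
  · rw [comp_hom, ← id_hom]
    refine hom_eq_of_le ?_
    refine compRel_elim (F.op inj surj) F (x := fun p : B.X × B.X => p.1) (z := fun p => p.2)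
      (P.le_refl _) ?_
    intro δ _ h1 h2
    exact F.single' h1 h2

/-- The functional relation given by a function which respects equality. -/
def FuncRel.ofFun (f : A.X → B.X)
    (hf : P.le (fun p : A.X × A.X => A.eq p.1 p.2) (fun p => B.eq (f p.1) (f p.2))) :
    FuncRel A B where
  rel x y := T.inf (A.eq x x) (B.eq (f x) y)
  strict := by
    have h := P.le_refl (fun p : A.X × B.X => T.inf (A.eq p.1 p.1) (B.eq (f p.1) p.2))
    exact T.inf_intro (T.inf_left h) (B.refl_right (T.inf_right h))
  congr := by
    have h := P.le_refl (fun p : (A.X × A.X) × (B.X × B.X) =>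
      T.inf (T.inf (A.eq p.1.1 p.1.1) (B.eq (f p.1.1) p.2.1))
        (T.inf (A.eq p.1.1 p.1.2) (B.eq p.2.1 p.2.2)))
    have h1 := T.inf_right (T.inf_left h)
    have h2 := T.inf_left (T.inf_right h)
    have h3 := T.inf_right (T.inf_right h)
    have h4 := P.le_trans h2
      (P.le_reindex (fun p : (A.X × A.X) × (B.X × B.X) => (p.1.1, p.1.2)) hf)
    exact T.inf_intro (A.refl_right h2) (B.trans' (B.symm' h4) (B.trans' h1 h3))
  single := by
    have h := P.le_refl (fun p : A.X × B.X × B.X =>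
      T.inf (T.inf (A.eq p.1 p.1) (B.eq (f p.1) p.2.1))
        (T.inf (A.eq p.1 p.1) (B.eq (f p.1) p.2.2)))
    exact B.trans' (B.symm' (T.inf_right (T.inf_left h))) (T.inf_right (T.inf_right h))
  total := T.some_intro (fun x y => T.inf (A.eq x x) (B.eq (f x) y)) (fun x => x) f
    (T.inf_intro (P.le_refl _) (P.le_reindex (fun x => (x, x)) hf))

section OfFun

variable {f g : A.X → B.X}
  {hf : P.le (fun p : A.X × A.X => A.eq p.1 p.2) (fun p => B.eq (f p.1) (f p.2))}
  {hg : P.le (fun p : A.X × A.X => A.eq p.1 p.2) (fun p => B.eq (g p.1) (g p.2))}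

theorem FuncRel.ofFun_intro {K : Type u} {γ : K → P.Val} {x : K → A.X} {y : K → B.X}
    (h : P.le γ (fun k => A.eq (x k) (x k))) (h' : P.le γ (fun k => B.eq (f (x k)) (y k))) :
    P.le γ (fun k => (FuncRel.ofFun f hf).rel (x k) (y k)) :=
  T.inf_intro h h'

theorem FuncRel.ofFun_self {K : Type u} {γ : K → P.Val} {x : K → A.X}
    (h : P.le γ (fun k => A.eq (x k) (x k))) :
    P.le γ (fun k => (FuncRel.ofFun f hf).rel (x k) (f (x k))) :=
  T.inf_intro h (P.le_trans h (P.le_reindex (fun k => (x k, x k)) hf))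

theorem FuncRel.ofFun_left {K : Type u} {γ : K → P.Val} {x : K → A.X} {y : K → B.X}
    (h : P.le γ (fun k => (FuncRel.ofFun f hf).rel (x k) (y k))) :
    P.le γ (fun k => A.eq (x k) (x k)) :=
  T.inf_left h

theorem FuncRel.ofFun_right {K : Type u} {γ : K → P.Val} {x : K → A.X} {y : K → B.X}
    (h : P.le γ (fun k => (FuncRel.ofFun f hf).rel (x k) (y k))) :
    P.le γ (fun k => B.eq (f (x k)) (y k)) :=
  T.inf_right h

/-- Turns an equation between morphisms into an internal equation between elements. It is applied to
the two projections of suitable subobjects of a product `A × A`. -/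
theorem FuncRel.eq_of_ofFun_hom_eq
    (h : (FuncRel.ofFun f hf).hom = (FuncRel.ofFun g hg).hom) {K : Type u} {γ : K → P.Val}
    {x : K → A.X} (hx : P.le γ (fun k => A.eq (x k) (x k))) :
    P.le γ (fun k => B.eq (f (x k)) (g (x k))) :=
  B.symm' (ofFun_right (hf := hg) (le_of_equiv (hom_eq_iff.1 h) (ofFun_self hx)))

theorem FuncRel.ofFun_comp_intro {F : FuncRel B C} {K : Type u} {γ : K → P.Val}
    {x : K → A.X} {z : K → C.X} (h : P.le γ (fun k => A.eq (x k) (x k)))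
    (h' : P.le γ (fun k => F.rel (f (x k)) (z k))) :
    P.le γ (fun k => (FuncRel.comp (FuncRel.ofFun f hf) F).rel (x k) (z k)) :=
  compRel_intro _ F (fun k => f (x k)) (ofFun_self h) h'

theorem FuncRel.ofFun_comp_right {F : FuncRel B C} {K : Type u} {γ : K → P.Val}
    {x : K → A.X} {z : K → C.X}
    (h : P.le γ (fun k => (FuncRel.comp (FuncRel.ofFun f hf) F).rel (x k) (z k))) :
    P.le γ (fun k => F.rel (f (x k)) (z k)) := by
  refine compRel_elim _ F h ?_
  intro δ _ h1 h2
  exact F.congr' h2 (B.symm' (ofFun_right h1)) (F.right h2)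

end OfFun

/-- The subobject of `A` given by a predicate which respects equality. -/
def Obj.sub (A : Obj T) (p : A.X → P.Val)
    (hp : P.le (fun x : A.X × A.X => T.inf (p x.1) (A.eq x.1 x.2)) (fun x => p x.2)) :
    Obj T where
  X := A.X
  eq x y := T.inf (A.eq x y) (p x)
  symm := by
    have h := P.le_refl (fun x : A.X × A.X => T.inf (A.eq x.1 x.2) (p x.1))
    exact T.inf_intro (A.symm' (T.inf_left h))
      (P.le_trans (T.inf_intro (T.inf_right h) (T.inf_left h)) hp)
  trans := by
    have h := P.le_refl (fun x : A.X × A.X × A.X =>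
      T.inf (T.inf (A.eq x.1 x.2.1) (p x.1)) (T.inf (A.eq x.2.1 x.2.2) (p x.2.1)))
    exact T.inf_intro (A.trans' (T.inf_left (T.inf_left h)) (T.inf_left (T.inf_right h)))
      (T.inf_right (T.inf_left h))

section Sub

variable {p : A.X → P.Val}
  {hp : P.le (fun x : A.X × A.X => T.inf (p x.1) (A.eq x.1 x.2)) (fun x => p x.2)}

theorem Obj.sub_intro {K : Type u} {γ : K → P.Val} {x y : K → A.X}
    (h : P.le γ (fun k => A.eq (x k) (y k))) (h' : P.le γ (fun k => p (x k))) :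
    P.le γ (fun k => (A.sub p hp).eq (x k) (y k)) :=
  T.inf_intro h h'

theorem Obj.sub_eq {K : Type u} {γ : K → P.Val} {x y : K → A.X}
    (h : P.le γ (fun k => (A.sub p hp).eq (x k) (y k))) :
    P.le γ (fun k => A.eq (x k) (y k)) :=
  T.inf_left h

theorem Obj.sub_pred {K : Type u} {γ : K → P.Val} {x y : K → A.X}
    (h : P.le γ (fun k => (A.sub p hp).eq (x k) (y k))) : P.le γ (fun k => p (x k)) :=
  T.inf_right h

variable (A p hp)

/-- The inclusion of a subobject. -/
def Obj.incl : FuncRel (A.sub p hp) A :=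
  FuncRel.ofFun (fun x : A.X => x) (A.sub_eq (P.le_refl _))

instance Obj.mono_incl : Mono (A.incl p hp).hom := by
  refine ⟨fun {X} g h e => ?_⟩
  obtain ⟨G, rfl⟩ := FuncRel.exists_hom g
  obtain ⟨H, rfl⟩ := FuncRel.exists_hom h
  rw [FuncRel.comp_hom, FuncRel.comp_hom, FuncRel.hom_eq_iff] at e
  refine FuncRel.hom_eq_of_le ?_
  have h0 : P.le (fun p : X.X × A.X => G.rel p.1 p.2) (fun p => G.rel p.1 p.2) :=
    P.le_refl _
  have h1 := FuncRel.compRel_intro G (A.incl p hp) (fun p : X.X × A.X => p.2) h0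
    (FuncRel.ofFun_self (G.right h0))
  refine FuncRel.compRel_elim H (A.incl p hp) (FuncRel.le_of_equiv e h1) ?_
  intro δ _ h2 h3
  exact H.congr' h2 (H.left h2) (A.sub_intro (FuncRel.ofFun_right h3)
    (A.sub_pred (H.right h2)))

end Sub

/-- The product of two objects. -/
def Obj.prod (A B : Obj T) : Obj T where
  X := A.X × B.X
  eq x y := T.inf (A.eq x.1 y.1) (B.eq x.2 y.2)
  symm := by
    have h := P.le_refl (fun x : (A.X × B.X) × (A.X × B.X) =>
      T.inf (A.eq x.1.1 x.2.1) (B.eq x.1.2 x.2.2))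
    exact T.inf_intro (A.symm' (T.inf_left h)) (B.symm' (T.inf_right h))
  trans := by
    have h := P.le_refl (fun x : (A.X × B.X) × (A.X × B.X) × (A.X × B.X) =>
      T.inf (T.inf (A.eq x.1.1 x.2.1.1) (B.eq x.1.2 x.2.1.2))
        (T.inf (A.eq x.2.1.1 x.2.2.1) (B.eq x.2.1.2 x.2.2.2)))
    exact T.inf_intro (A.trans' (T.inf_left (T.inf_left h)) (T.inf_left (T.inf_right h)))
      (B.trans' (T.inf_right (T.inf_left h)) (T.inf_right (T.inf_right h)))

theorem Obj.prod_fst {K : Type u} {γ : K → P.Val} {x y : K → A.X × B.X}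
    (h : P.le γ (fun k => (A.prod B).eq (x k) (y k))) :
    P.le γ (fun k => A.eq (x k).1 (y k).1) :=
  T.inf_left h

theorem Obj.prod_snd {K : Type u} {γ : K → P.Val} {x y : K → A.X × B.X}
    (h : P.le γ (fun k => (A.prod B).eq (x k) (y k))) :
    P.le γ (fun k => B.eq (x k).2 (y k).2) :=
  T.inf_right h

theorem Obj.prod_intro {K : Type u} {γ : K → P.Val} {x y : K → A.X × B.X}
    (h : P.le γ (fun k => A.eq (x k).1 (y k).1)) (h' : P.le γ (fun k => B.eq (x k).2 (y k).2)) :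
    P.le γ (fun k => (A.prod B).eq (x k) (y k)) :=
  T.inf_intro h h'

end Morphisms

/-! ### The closed subtopos complementary to a truth value -/

section Closed

variable {P : IndexedPreorder.{u}} {T : P.Tripos} {u : P.Val} {A B C : Obj T}

/-- To the extent `u`, the object `A` has exactly one element. -/
structure Obj.IsClosed (u : P.Val) (A : Obj T) : Prop where
  inhabited : P.le (fun _ : PUnit.{u + 1} => u)
    (T.some (fun (_ : PUnit.{u + 1}) (x : A.X) => A.eq x x))
  unique : P.le (fun x : A.X × A.X => T.inf u (T.inf (A.eq x.1 x.1) (A.eq x.2 x.2)))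
    (fun x => A.eq x.1 x.2)

theorem Obj.IsClosed.inhabited' (hA : A.IsClosed u) {K : Type u} {γ : K → P.Val}
    (h : P.le γ (fun _ => u)) :
    P.le γ (fun _ => T.some (fun (_ : PUnit.{u + 1}) (x : A.X) => A.eq x x) PUnit.unit) :=
  P.le_trans h (P.le_reindex (fun _ => PUnit.unit) hA.inhabited)

theorem Obj.IsClosed.unique' (hA : A.IsClosed u) {K : Type u} {γ : K → P.Val}
    {x y : K → A.X} (h : P.le γ (fun _ => u)) (hx : P.le γ (fun k => A.eq (x k) (x k)))
    (hy : P.le γ (fun k => A.eq (y k) (y k))) : P.le γ (fun k => A.eq (x k) (y k)) :=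
  P.le_trans (T.inf_intro h (T.inf_intro hx hy))
    (P.le_reindex (fun k => (x k, y k)) hA.unique)

theorem nonempty_hom_subterminal_iff :
    Nonempty (A ⟶ T.subterminal u) ↔ P.le (fun x : A.X => A.eq x x) (fun _ => u) := by
  constructor
  · rintro ⟨f⟩
    obtain ⟨F, rfl⟩ := FuncRel.exists_hom f
    refine T.some_cases (φ := F.rel) (g := fun x : A.X => x) F.total ?_
    intro δ _ h
    exact F.right h
  · intro h
    refine ⟨(FuncRel.ofFun (fun _ => PUnit.unit) ?_).hom⟩
    exact P.le_trans (A.refl_left (P.le_refl _))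
      (P.le_reindex (fun x : A.X × A.X => x.1) h)

theorem Obj.IsClosed.prod (hA : A.IsClosed u) (hB : B.IsClosed u) :
    (A.prod B).IsClosed u where
  inhabited := by
    refine T.some_cases (φ := fun (_ : PUnit.{u + 1}) (x : A.X) => A.eq x x)
      (g := fun _ => PUnit.unit) hA.inhabited ?_
    intro δ h1 h2
    refine T.some_cases (φ := fun (_ : PUnit.{u + 1}) (x : B.X) => B.eq x x)
      (g := fun _ => PUnit.unit) (hB.inhabited' h1) ?_
    intro ε h3 h4
    exact T.some_intro (fun (_ : PUnit.{u + 1}) (x : (A.prod B).X) => (A.prod B).eq x x)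
      (fun _ => PUnit.unit) (fun p => (p.1.2, p.2))
      (T.inf_intro (P.weaken Prod.fst h3 h2) h4)
  unique := by
    have h := P.le_refl (fun x : (A.prod B).X × (A.prod B).X =>
      T.inf u (T.inf ((A.prod B).eq x.1 x.1) ((A.prod B).eq x.2 x.2)))
    have h1 := T.inf_left (T.inf_right h)
    have h2 := T.inf_right (T.inf_right h)
    exact A.prod_intro (hA.unique' (T.inf_left h) (A.prod_fst h1) (A.prod_fst h2))
      (hB.unique' (T.inf_left h) (A.prod_snd h1) (A.prod_snd h2))

/-- A subobject could lose the one element that `A` has to the extent `u`. The condition `u ∧ E x ≤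
p x` excludes this, and it is checked for every subobject formed below inside the closed subtopos.
-/
theorem Obj.IsClosed.sub (hA : A.IsClosed u) {p : A.X → P.Val}
    {hp : P.le (fun x : A.X × A.X => T.inf (p x.1) (A.eq x.1 x.2)) (fun x => p x.2)}
    (h : P.le (fun x : A.X => T.inf u (A.eq x x)) p) : (A.sub p hp).IsClosed u where
  inhabited := by
    refine T.some_cases (φ := fun (_ : PUnit.{u + 1}) (x : A.X) => A.eq x x)
      (g := fun _ => PUnit.unit) hA.inhabited ?_
    intro δ h1 h2
    have h3 : P.le δ (fun k => (A.sub p hp).eq k.2 k.2) :=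
      A.sub_intro h2 (P.le_trans (T.inf_intro h1 h2)
        (P.le_reindex (fun k : PUnit.{u + 1} × A.X => k.2) h))
    exact T.some_intro (fun (_ : PUnit.{u + 1}) (x : A.X) => (A.sub p hp).eq x x)
      (fun _ => PUnit.unit) (fun k => k.2) h3
  unique := by
    have h := P.le_refl (fun x : A.X × A.X =>
      T.inf u (T.inf ((A.sub p hp).eq x.1 x.1) ((A.sub p hp).eq x.2 x.2)))
    have h1 := T.inf_left (T.inf_right h)
    have h2 := T.inf_right (T.inf_right h)
    exact A.sub_intro (hA.unique' (T.inf_left h) (A.sub_eq h1) (A.sub_eq h2)) (A.sub_pred h1)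

/-- The external condition is tested on two objects over `u`: existence on `u` itself, uniqueness on
the restriction of `A × A` to `u` with its two projections. Conversely, over `u` the relation `E x ∧
E y` is functional, and strictness puts every other functional relation inside it. -/
theorem closedSubtopos_iff : closedSubtopos (T.subterminal u) A ↔ A.IsClosed u := by
  constructor
  · intro h
    constructor
    · obtain ⟨f, -⟩ := h (T.subterminal u) ⟨𝟙 _⟩
      obtain ⟨F, rfl⟩ := FuncRel.exists_hom f
      refine T.some_cases (φ := F.rel) (g := fun x => x) F.total ?_
      intro δ _ h2
      have h3 := F.right h2
      exact T.some_intro (fun (_ : PUnit.{u + 1}) (x : A.X) => A.eq x x)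
        (fun _ => PUnit.unit) (fun p => p.2) h3
    · have hp : P.le (fun x : (A.prod A).X × (A.prod A).X =>
          T.inf u ((A.prod A).eq x.1 x.2)) (fun _ => u) := T.inf_left (P.le_refl _)
      let X := (A.prod A).sub (fun _ => u) hp
      have hX : Nonempty (X ⟶ T.subterminal u) :=
        nonempty_hom_subterminal_iff.2 ((A.prod A).sub_pred (hp := hp) (P.le_refl _))
      have e := (h X hX).unique
        (y₁ := (FuncRel.ofFun (B := A) (fun x : A.X × A.X => x.1)
          (A.prod_fst ((A.prod A).sub_eq (hp := hp) (P.le_refl _)))).hom)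
        (y₂ := (FuncRel.ofFun (B := A) (fun x : A.X × A.X => x.2)
          (A.prod_snd ((A.prod A).sub_eq (hp := hp) (P.le_refl _)))).hom)
        trivial trivial
      have h0 := P.le_refl (fun x : A.X × A.X =>
        T.inf u (T.inf (A.eq x.1 x.1) (A.eq x.2 x.2)))
      exact FuncRel.eq_of_ofFun_hom_eq e (x := fun x : A.X × A.X => x)
        ((A.prod A).sub_intro (hp := hp) (T.inf_right h0) (T.inf_left h0))
  · intro hA X hX
    rw [nonempty_hom_subterminal_iff] at hX
    have hX' : ∀ {K : Type u} {γ : K → P.Val} {x : K → X.X},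
        P.le γ (fun k => X.eq (x k) (x k)) → P.le γ (fun _ => u) :=
      fun {K γ x} h => P.le_trans h (P.le_reindex x hX)
    refine ⟨FuncRel.hom
      { rel := fun x y => T.inf (X.eq x x) (A.eq y y)
        strict := P.le_refl _
        congr := ?_
        single := ?_
        total := ?_ }, trivial, ?_⟩
    · have h := P.le_refl (fun p : (X.X × X.X) × (A.X × A.X) =>
        T.inf (T.inf (X.eq p.1.1 p.1.1) (A.eq p.2.1 p.2.1))
          (T.inf (X.eq p.1.1 p.1.2) (A.eq p.2.1 p.2.2)))
      exact T.inf_intro (X.refl_right (T.inf_left (T.inf_right h)))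
        (A.refl_right (T.inf_right (T.inf_right h)))
    · have h := P.le_refl (fun p : X.X × A.X × A.X =>
        T.inf (T.inf (X.eq p.1 p.1) (A.eq p.2.1 p.2.1))
          (T.inf (X.eq p.1 p.1) (A.eq p.2.2 p.2.2)))
      exact hA.unique' (hX' (T.inf_left (T.inf_left h))) (T.inf_right (T.inf_left h))
        (T.inf_right (T.inf_right h))
    · refine T.some_cases (φ := fun (_ : PUnit.{u + 1}) (x : A.X) => A.eq x x)
        (g := fun _ => PUnit.unit) (hA.inhabited' hX) ?_
      intro δ h1 h2
      exact T.some_intro (fun x y => T.inf (X.eq x x) (A.eq y y)) (fun p : X.X × A.X => p.1)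
        (fun p => p.2) (T.inf_intro h1 h2)
    · intro f _
      obtain ⟨F, rfl⟩ := FuncRel.exists_hom f
      exact FuncRel.hom_eq_of_le F.strict

theorem isClosed_subterminal : (T.subterminal u).IsClosed u where
  inhabited := T.some_intro (fun (_ _ : PUnit.{u + 1}) => u) (fun x => x) (fun x => x)
    (P.le_refl _)
  unique := T.inf_left (P.le_refl _)

/-- The closed subtopos complementary to the truth value `u`. -/
abbrev ClosedSub (T : P.Tripos) (u : P.Val) : Type (u + 1) :=
  (closedSubtopos (T.subterminal u)).FullSubcategory

theorem ClosedSub.isClosed (S : ClosedSub T u) : S.obj.IsClosed u :=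
  closedSubtopos_iff.1 S.property

/-- An object of the closed subtopos. -/
def Obj.IsClosed.mk' (hA : A.IsClosed u) : ClosedSub T u := ⟨A, closedSubtopos_iff.2 hA⟩

/-- The subterminal object `u` lies in the closed subtopos, so an initial object maps to it.
Conversely, an object over `u` has exactly one morphism to each closed object by the definition of
the closed subtopos. Hence `u` plays the role of falsity. -/
theorem ClosedSub.isInitial_iff (S : ClosedSub T u) :
    Nonempty (Limits.IsInitial S) ↔ P.le (fun x : S.obj.X => S.obj.eq x x) (fun _ => u) := by
  rw [← nonempty_hom_subterminal_iff]
  constructor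
  · rintro ⟨h⟩
    exact ⟨(h.to (isClosed_subterminal (T := T) (u := u)).mk').hom⟩
  · intro h
    have (F : ClosedSub T u) : ∃ f : S ⟶ F, ∀ g : S ⟶ F, g = f := by
      obtain ⟨f, -, hf⟩ := F.property S.obj h
      exact ⟨ObjectProperty.homMk f, fun g => ObjectProperty.hom_ext _ (hf _ trivial)⟩
    choose f hf using this
    exact ⟨Limits.IsInitial.ofUniqueHom f (fun F g => hf F g)⟩

/-- The corestriction of a functional relation to a subobject. -/
def FuncRel.codRestrict (F : FuncRel B A) {p : A.X → P.Val}
    (hp : P.le (fun x : A.X × A.X => T.inf (p x.1) (A.eq x.1 x.2)) (fun x => p x.2))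
    (h : P.le (fun x : B.X × A.X => F.rel x.1 x.2) (fun x => p x.2)) :
    FuncRel B (A.sub p hp) where
  rel := F.rel
  strict := T.inf_intro (F.left (P.le_refl _)) (A.sub_intro (F.right (P.le_refl _)) h)
  congr := by
    have h0 := P.le_refl (fun x : (B.X × B.X) × (A.X × A.X) =>
      T.inf (F.rel x.1.1 x.2.1) (T.inf (B.eq x.1.1 x.1.2) ((A.sub p hp).eq x.2.1 x.2.2)))
    exact F.congr' (T.inf_left h0) (T.inf_left (T.inf_right h0))
      (A.sub_eq (T.inf_right (T.inf_right h0)))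
  single := by
    have h0 := P.le_refl (fun x : B.X × A.X × A.X =>
      T.inf (F.rel x.1 x.2.1) (F.rel x.1 x.2.2))
    exact A.sub_intro (F.single' (T.inf_left h0) (T.inf_right h0))
      (P.le_trans (T.inf_left h0)
        (P.le_reindex (fun x : B.X × A.X × A.X => (x.1, x.2.1)) h))
  total := F.total

theorem FuncRel.codRestrict_comp_incl (F : FuncRel B A) {p : A.X → P.Val}
    (hp : P.le (fun x : A.X × A.X => T.inf (p x.1) (A.eq x.1 x.2)) (fun x => p x.2))
    (h : P.le (fun x : B.X × A.X => F.rel x.1 x.2) (fun x => p x.2)) :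
    (F.codRestrict hp h).hom ≫ (A.incl p hp).hom = F.hom := by
  rw [FuncRel.comp_hom]
  refine FuncRel.hom_eq_of_le ?_
  refine FuncRel.compRel_elim (F.codRestrict hp h) (A.incl p hp)
    (x := fun x : B.X × A.X => x.1) (z := fun x => x.2) (P.le_refl _) ?_
  intro δ _ h1 h2
  have h3 : P.le δ (fun x => F.rel x.1.1 x.2) := h1
  exact F.congr' h3 (F.left h3) (FuncRel.ofFun_right h2)

/-- A subobject in the closed subtopos is dense if its double negation relative to `u` is the
whole object. -/
theorem doubleNegDense_incl (hA : A.IsClosed u) {p : A.X → P.Val}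
    {hp : P.le (fun x : A.X × A.X => T.inf (p x.1) (A.eq x.1 x.2)) (fun x => p x.2)}
    (h : P.le (fun x : A.X => T.inf u (A.eq x x)) p)
    (hd : P.le (fun x : A.X => A.eq x x) (fun x => T.nn u (p x))) :
    doubleNegDense (ClosedSub T u)
      (ObjectProperty.homMk (A.incl p hp).hom : (hA.sub (hp := hp) h).mk' ⟶ hA.mk') := by
  constructor
  · refine ⟨fun {X} g h e => ObjectProperty.hom_ext _ ?_⟩
    refine (cancel_mono (A.incl p hp).hom).1 ?_
    exact congrArg InducedCategory.Hom.hom e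
  · intro S s _ hs
    obtain ⟨s, rfl⟩ := ObjectProperty.homMk_surjective s
    obtain ⟨F, rfl⟩ := FuncRel.exists_hom s
    change FuncRel S.obj A at F
    -- The preimage of `p` under `F`. Its inclusion into `S` followed by `F` factors through `p`, so
    -- the disjointness hypothesis will make it initial.
    let q : S.obj.X → P.Val :=
      T.some (fun x (y : A.X) => T.inf (F.rel x y) (p y))
    have q_intro : ∀ {K : Type u} {γ : K → P.Val} {x : K → S.obj.X} {y : K → A.X},
        P.le γ (fun k => F.rel (x k) (y k)) → P.le γ (fun k => p (y k)) →
        P.le γ (fun k => q (x k)) :=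
      fun {K γ x y} h h' => T.some_intro (fun x (y : A.X) => T.inf (F.rel x y) (p y)) x y
        (T.inf_intro h h')
    have hq : P.le (fun x : S.obj.X × S.obj.X => T.inf (q x.1) (S.obj.eq x.1 x.2))
        (fun x => q x.2) := by
      have h := P.le_refl (fun x : S.obj.X × S.obj.X => T.inf (q x.1) (S.obj.eq x.1 x.2))
      refine T.some_cases (φ := fun x (y : A.X) => T.inf (F.rel x y) (p y))
        (g := fun x : S.obj.X × S.obj.X => x.1) (T.inf_left h) ?_
      intro δ h1 h2
      exact q_intro (F.congr' (T.inf_left h2) (P.weaken Prod.fst h1 (T.inf_right h))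
        (F.right (T.inf_left h2))) (T.inf_right h2)
    have hX : (S.obj.sub q hq).IsClosed u := by
      refine S.isClosed.sub ?_
      have h0 := P.le_refl (fun x : S.obj.X => T.inf u (S.obj.eq x x))
      refine T.some_cases (φ := F.rel) (g := fun x : S.obj.X => x)
        (F.total' (T.inf_right h0)) ?_
      intro δ h1 h2
      exact q_intro h2 (P.le_trans (T.inf_intro (T.inf_left h1) (F.right h2))
        (P.le_reindex (fun x : S.obj.X × A.X => x.2) h))
    have hG : P.le (fun x : S.obj.X × A.X =>
        (FuncRel.comp (S.obj.incl q hq) F).rel x.1 x.2) (fun x => p x.2) := by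
      have h0 := P.le_refl (fun x : S.obj.X × A.X =>
        (FuncRel.comp (S.obj.incl q hq) F).rel x.1 x.2)
      have h1 := S.obj.sub_pred (hp := hq)
        ((FuncRel.comp (S.obj.incl q hq) F).left h0)
      refine T.some_cases (φ := fun x (y : A.X) => T.inf (F.rel x y) (p y)) h1 ?_
      intro δ h2 h3
      have h4 := FuncRel.ofFun_comp_right h2
      exact P.le_trans (T.inf_intro (T.inf_right h3) (F.single' (T.inf_left h3) h4))
        (P.le_reindex (fun x : (S.obj.X × A.X) × A.X => (x.2, x.1.2)) hp)
    have hI := (ClosedSub.isInitial_iff _).1 (hs hX.mk'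
      (ObjectProperty.homMk (S.obj.incl q hq).hom)
      (ObjectProperty.homMk
        ((FuncRel.comp (S.obj.incl q hq) F).codRestrict hp hG).hom)
      (ObjectProperty.hom_ext _ (FuncRel.codRestrict_comp_incl _ hp hG).symm))
    rw [ClosedSub.isInitial_iff]
    -- Let `y` be the value of `F` at `x`. From `p y` follows `q x` and so `u`; since `p y` holds up
    -- to double negation, `u` follows.
    refine T.some_cases (φ := F.rel) (g := fun x : S.obj.X => x) F.total ?_
    intro δ _ h1
    refine T.himp_elim (P.le_trans (F.right h1)
      (P.le_reindex (fun x : S.obj.X × A.X => x.2) hd)) (T.himp_intro ?_)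
    intro ε h2 h3
    have h4 := P.le_trans h2 h1
    exact P.le_trans (S.obj.sub_intro (hp := hq) (F.left h4) (q_intro h4 h3))
      (P.le_reindex (fun x : S.obj.X × A.X => x.1) hI)

/-- A dense monomorphism of the closed subtopos is injective. -/
theorem FuncRel.injective_of_mono (hA : A.IsClosed u) (hB : B.IsClosed u) (F : FuncRel A B)
    (hF : Mono (ObjectProperty.homMk F.hom : hA.mk' ⟶ hB.mk')) :
    P.le (fun p : A.X × A.X × B.X => T.inf (F.rel p.1 p.2.2) (F.rel p.2.1 p.2.2))
      (fun p => A.eq p.1 p.2.1) := by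
  -- The kernel pair of `F`. The monomorphism equalizes its two projections, which is injectivity.
  let q : A.X × A.X → P.Val :=
    T.some (fun (x : A.X × A.X) (y : B.X) => T.inf (F.rel x.1 y) (F.rel x.2 y))
  have q_intro : ∀ {K : Type u} {γ : K → P.Val} {x : K → A.X × A.X} {y : K → B.X},
      P.le γ (fun k => F.rel (x k).1 (y k)) → P.le γ (fun k => F.rel (x k).2 (y k)) →
      P.le γ (fun k => q (x k)) :=
    fun {K γ x y} h h' => T.some_intro (fun (x : A.X × A.X) (y : B.X) => T.inf (F.rel x.1 y) (F.rel x.2 y))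
      x y (T.inf_intro h h')
  have hq : P.le (fun x : (A.prod A).X × (A.prod A).X =>
      T.inf (q x.1) ((A.prod A).eq x.1 x.2)) (fun x => q x.2) := by
    have h := P.le_refl (fun x : (A.prod A).X × (A.prod A).X =>
      T.inf (q x.1) ((A.prod A).eq x.1 x.2))
    refine T.some_cases (φ := fun (x : A.X × A.X) (y : B.X) => T.inf (F.rel x.1 y) (F.rel x.2 y))
      (T.inf_left h) ?_
    intro δ h1 h2
    have h3 := P.weaken Prod.fst h1 (T.inf_right h)
    exact q_intro
      (F.congr' (T.inf_left h2) (A.prod_fst h3) (F.right (T.inf_left h2)))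
      (F.congr' (T.inf_right h2) (A.prod_snd h3) (F.right (T.inf_left h2)))
  have hX : ((A.prod A).sub q hq).IsClosed u := by
    refine (hA.prod hA).sub ?_
    have h0 := P.le_refl (fun x : A.X × A.X => T.inf u ((A.prod A).eq x x))
    refine T.some_cases (φ := F.rel) (g := fun x : A.X × A.X => x.1)
      (F.total' (A.prod_fst (T.inf_right h0))) ?_
    intro δ h1 h2
    -- To the extent `u` the two components are equal, hence have the same value under `F`.
    have h3 := A.prod_snd (T.inf_right h1)
    exact q_intro h2 (F.congr' h2
      (hA.unique' (T.inf_left h1) (F.left h2) h3) (F.right h2))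
  let f₁ : FuncRel ((A.prod A).sub q hq) A := FuncRel.ofFun (fun x : A.X × A.X => x.1)
    (A.prod_fst ((A.prod A).sub_eq (hp := hq) (P.le_refl _)))
  let f₂ : FuncRel ((A.prod A).sub q hq) A := FuncRel.ofFun (fun x : A.X × A.X => x.2)
    (A.prod_snd ((A.prod A).sub_eq (hp := hq) (P.le_refl _)))
  have e : f₁.hom ≫ F.hom = f₂.hom ≫ F.hom := by
    rw [FuncRel.comp_hom, FuncRel.comp_hom]
    refine FuncRel.hom_eq_of_le ?_
    have h0 := P.le_refl (fun x : (A.X × A.X) × B.X => (FuncRel.comp f₁ F).rel x.1 x.2)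
    have h1 := (FuncRel.comp f₁ F).left h0
    have h2 := FuncRel.ofFun_comp_right h0
    refine T.some_cases (φ := fun (x : A.X × A.X) (y : B.X) => T.inf (F.rel x.1 y) (F.rel x.2 y))
      ((A.prod A).sub_pred (hp := hq) h1) ?_
    intro δ h3 h4
    have h5 := F.single' (T.inf_left h4) (P.weaken Prod.fst h3 h2)
    exact FuncRel.ofFun_comp_intro (P.weaken Prod.fst h3 h1)
      (F.congr' (T.inf_right h4) (F.left (T.inf_right h4)) h5)
  have e' : f₁.hom = f₂.hom := by
    have := hF.right_cancellation (Z := hX.mk') (ObjectProperty.homMk f₁.hom)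
      (ObjectProperty.homMk f₂.hom) (ObjectProperty.hom_ext _ e)
    exact congrArg InducedCategory.Hom.hom this
  have h0 := P.le_refl (fun p : A.X × A.X × B.X =>
    T.inf (F.rel p.1 p.2.2) (F.rel p.2.1 p.2.2))
  have h1 := T.inf_left h0
  have h2 := T.inf_right h0
  exact FuncRel.eq_of_ofFun_hom_eq e' (x := fun p : A.X × A.X × B.X => (p.1, p.2.1))
    ((A.prod A).sub_intro (hp := hq) (T.inf_intro (F.left h1) (F.left h2)) (q_intro h1 h2))

/-- The image of a dense monomorphism of the closed subtopos is dense. -/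
theorem FuncRel.nn_surjective_of_doubleNegDense (hA : A.IsClosed u) (hB : B.IsClosed u)
    (F : FuncRel A B)
    (hF : doubleNegDense (ClosedSub T u) (ObjectProperty.homMk F.hom : hA.mk' ⟶ hB.mk')) :
    P.le (fun y : B.X => B.eq y y)
      (fun y => T.nn u (T.some (fun (y : B.X) (x : A.X) => F.rel x y) y)) := by
  let r : B.X → P.Val := T.some (fun (y : B.X) (x : A.X) => F.rel x y)
  have hr : P.le (fun y : B.X × B.X => T.inf (r y.1) (B.eq y.1 y.2)) (fun y => r y.2) := by
    have h := P.le_refl (fun y : B.X × B.X => T.inf (r y.1) (B.eq y.1 y.2))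
    refine T.some_cases (φ := fun (y : B.X) (x : A.X) => F.rel x y) (T.inf_left h) ?_
    intro δ h1 h2
    have h3 := F.congr' h2 (F.left h2) (P.weaken Prod.fst h1 (T.inf_right h))
    exact T.some_intro (fun (y : B.X) (x : A.X) => F.rel x y) (fun p : (B.X × B.X) × A.X => p.1.2)
      (fun p => p.2) h3
  -- The complement, relative to `u`, of the image `r` of `F`. It is disjoint from `A`, so density
  -- makes it initial: `r y ⇒ u` implies `u`, which is the double negation of `r y`.
  let q : B.X → P.Val := fun y => T.himp (r y) u
  have hq : P.le (fun y : B.X × B.X => T.inf (q y.1) (B.eq y.1 y.2)) (fun y => q y.2) := by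
    refine T.himp_intro ?_
    intro δ h1 h2
    exact T.himp_elim (T.inf_left h1) (P.le_trans (T.inf_intro h2 (B.symm' (T.inf_right h1)))
      (P.le_reindex (fun y : B.X × B.X => (y.2, y.1)) hr))
  have hX : (B.sub q hq).IsClosed u :=
    hB.sub (T.himp_intro (fun _ h1 _ => T.inf_left h1))
  have hI := (ClosedSub.isInitial_iff _).1 (hF.2 hX.mk' (ObjectProperty.homMk (B.incl q hq).hom)
    ⟨fun {X} g h e => ObjectProperty.hom_ext _ (by
      refine (cancel_mono (B.incl q hq).hom).1 ?_
      exact congrArg InducedCategory.Hom.hom e)⟩ (by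
      intro X f g e
      obtain ⟨f, rfl⟩ := ObjectProperty.homMk_surjective f
      obtain ⟨g, rfl⟩ := ObjectProperty.homMk_surjective g
      obtain ⟨f, rfl⟩ := FuncRel.exists_hom f
      obtain ⟨g, rfl⟩ := FuncRel.exists_hom g
      change FuncRel X.obj (B.sub q hq) at f
      change FuncRel X.obj A at g
      have e : f.hom ≫ (B.incl q hq).hom = g.hom ≫ F.hom :=
        congrArg InducedCategory.Hom.hom e
      rw [FuncRel.comp_hom, FuncRel.comp_hom, FuncRel.hom_eq_iff] at e
      rw [ClosedSub.isInitial_iff]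
      -- An element of `X` has a value in `B` that lies both in the complement (by `f`) and in the
      -- image (by `g` and `F`).
      refine T.some_cases (φ := f.rel) (g := fun x : X.obj.X => x) f.total ?_
      intro δ _ h1
      have h2 := f.right h1
      refine FuncRel.compRel_elim g F (FuncRel.le_of_equiv e
        (FuncRel.compRel_intro f (B.incl q hq) (fun p => p.2) h1 (FuncRel.ofFun_self h2))) ?_
      intro ε h3 _ h4
      exact T.himp_elim (P.weaken Prod.fst h3 (B.sub_pred h2))
        (T.some_intro (fun (y : B.X) (x : A.X) => F.rel x y)
          (fun p : (X.obj.X × B.X) × A.X => p.1.2) (fun p => p.2) h4)))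
  refine T.himp_intro ?_
  intro δ h1 h2
  exact P.le_trans (B.sub_intro (hp := hq) h1 h2) hI

end Closed

/-! ### Reflections given by double negation -/

/-- A reflection of the Set-indexed preorder underlying a tripos onto a Set-indexed preorder `Q`,
given pointwise by maps `F` and `G`, such that the resulting closure operator `G F` is double
negation relative to a truth value `u`. -/
structure NegNegReflection {P : IndexedPreorder.{u}} (T : P.Tripos) (Q : IndexedPreorder.{u})
    (u : P.Val) where
  F : P.Val → Q.Val
  G : Q.Val → P.Val
  adj : ∀ {I : Type u} (φ : I → P.Val) (ψ : I → Q.Val),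
    Q.le (fun i => F (φ i)) ψ ↔ P.le φ (fun i => G (ψ i))
  le_FG : ∀ {I : Type u} (ψ : I → Q.Val), Q.le ψ (fun i => F (G (ψ i)))
  GF_le_nn : ∀ {I : Type u} (φ : I → P.Val),
    P.le (fun i => G (F (φ i))) (fun i => T.nn u (φ i))
  nn_le_GF : ∀ {I : Type u} (φ : I → P.Val),
    P.le (fun i => T.nn u (φ i)) (fun i => G (F (φ i)))

namespace NegNegReflection

section Basic

variable {P Q : IndexedPreorder.{u}} {T : P.Tripos} {u : P.Val}
  (L : NegNegReflection T Q u) {K : Type u}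

theorem FG_le (ψ : K → Q.Val) : Q.le (fun i => L.F (L.G (ψ i))) ψ :=
  (L.adj _ _).2 (P.le_refl _)

theorem le_GF (φ : K → P.Val) : P.le φ (fun i => L.G (L.F (φ i))) :=
  (L.adj _ _).1 (Q.le_refl _)

theorem F_mono {φ ψ : K → P.Val} (h : P.le φ ψ) :
    Q.le (fun i => L.F (φ i)) (fun i => L.F (ψ i)) :=
  (L.adj _ _).2 (P.le_trans h (L.le_GF ψ))

theorem G_mono {φ ψ : K → Q.Val} (h : Q.le φ ψ) :
    P.le (fun i => L.G (φ i)) (fun i => L.G (ψ i)) :=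
  (L.adj _ _).1 (Q.le_trans (L.FG_le φ) h)

theorem le_of_G_le {φ ψ : K → Q.Val}
    (h : P.le (fun i => L.G (φ i)) (fun i => L.G (ψ i))) : Q.le φ ψ :=
  Q.le_trans (L.le_FG φ) ((L.adj _ _).2 h)

/-- Closed predicates are double negations, and these all contain `u`. For this reason objects whose
equality is of the form `G ψ` belong to the closed subtopos. -/
theorem le_G_of_bot {γ : K → P.Val} (h : P.le γ (fun _ => u)) (ψ : K → Q.Val) :
    P.le γ (fun i => L.G (ψ i)) :=
  P.le_trans (T.nn_of_bot h) (P.le_trans (L.nn_le_GF (fun i => L.G (ψ i)))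
    (L.G_mono (L.FG_le ψ)))

/-- Double negation preserves binary meets. This makes the reflection left exact, which is needed
for implication in `Q` and for transporting objects and functional relations. -/
theorem GF_inf {γ φ ψ : K → P.Val} (h : P.le γ (fun i => L.G (L.F (φ i))))
    (h' : P.le γ (fun i => L.G (L.F (ψ i)))) :
    P.le γ (fun i => L.G (L.F (T.inf (φ i) (ψ i)))) := by
  refine P.le_trans (T.nn_cases (P.le_trans h (L.GF_le_nn φ)) ?_) (L.nn_le_GF _)
  intro δ h1 h2
  refine T.nn_cases (P.le_trans h1 (P.le_trans h' (L.GF_le_nn ψ))) ?_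
  intro ε h3 h4
  exact T.nn_intro (T.inf_intro (P.le_trans h3 h2) h4)

/-- The tripos structure on a reflection. -/
def tripos : Q.Tripos where
  top := L.F T.top
  bot := L.F T.bot
  inf a b := L.F (T.inf (L.G a) (L.G b))
  sup a b := L.F (T.sup (L.G a) (L.G b))
  himp a b := L.F (T.himp (L.G a) (L.G b))
  ex f φ j := L.F (T.ex f (fun i => L.G (φ i)) j)
  all f φ j := L.F (T.all f (fun i => L.G (φ i)) j)
  le_top φ := Q.le_trans (L.le_FG φ) (L.F_mono (T.le_top _))
  bot_le φ := (L.adj _ _).2 (T.bot_le _)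
  le_inf_iff φ ψ χ := by
    constructor
    · intro h
      exact ⟨Q.le_trans h ((L.adj _ _).2 (T.inf_left (P.le_refl _))),
        Q.le_trans h ((L.adj _ _).2 (T.inf_right (P.le_refl _)))⟩
    · rintro ⟨h, h'⟩
      exact Q.le_trans (L.le_FG χ) (L.F_mono (T.inf_intro (L.G_mono h) (L.G_mono h')))
  sup_le_iff φ ψ χ := by
    rw [L.adj, T.sup_le_iff]
    exact ⟨fun h => ⟨L.le_of_G_le h.1, L.le_of_G_le h.2⟩,
      fun h => ⟨L.G_mono h.1, L.G_mono h.2⟩⟩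
  le_himp_iff φ ψ χ := by
    rw [L.adj, ← T.le_himp_iff]
    constructor
    · intro h
      refine P.le_trans (L.G_mono h) (T.himp_intro ?_)
      intro δ h1 h2
      -- The implication `G φ ⇒ G ψ` is itself closed: its closure together with `G φ` yields the
      -- closure of `G ψ`, which is `G ψ`.
      refine P.le_trans (L.GF_inf h1 (P.le_trans h2 (L.le_GF _))) (L.G_mono ?_)
      exact (L.adj _ _).2 (T.himp_elim (T.inf_left (P.le_refl _)) (T.inf_right (P.le_refl _)))
    · intro h
      exact Q.le_trans (L.le_FG χ) (L.F_mono h)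
  ex_le_iff f φ ψ := by
    rw [L.adj, T.ex_le_iff]
    exact ⟨fun h => L.le_of_G_le h, fun h => L.G_mono h⟩
  le_all_iff f φ ψ := by
    constructor
    · intro h
      refine Q.le_trans (Q.le_reindex f h) ((L.adj _ _).2 ?_)
      exact (T.le_all_iff f _ _).1 (P.le_refl _)
    · intro h
      exact Q.le_trans (L.le_FG ψ) (L.F_mono ((T.le_all_iff f _ _).2 (L.G_mono h)))
  ex_beckChevalley f g φ :=
    ⟨L.F_mono (T.ex_beckChevalley f g (fun i => L.G (φ i))).1, L.F_mono (T.ex_beckChevalley f g (fun i => L.G (φ i))).2⟩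
  all_beckChevalley f g φ :=
    ⟨L.F_mono (T.all_beckChevalley f g (fun i => L.G (φ i))).1, L.F_mono (T.all_beckChevalley f g (fun i => L.G (φ i))).2⟩

/-- `F` preserves binary meets by `GF_inf`. As a rule this avoids comparing `F` of a meet with a
meet chosen in `Q`; `G_map₂` is the analogue for `G`, where the adjunction alone suffices. -/
theorem F_map₂ {φ ψ χ : K → P.Val} {γ : K → Q.Val}
    (h : P.le (fun k => T.inf (φ k) (ψ k)) χ) (h₁ : Q.le γ (fun k => L.F (φ k)))
    (h₂ : Q.le γ (fun k => L.F (ψ k))) : Q.le γ (fun k => L.F (χ k)) :=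
  Q.le_trans (L.le_FG γ) ((L.adj _ _).2 (P.le_trans (L.GF_inf (L.G_mono h₁) (L.G_mono h₂))
    (L.G_mono (L.F_mono h))))

variable (S : Q.Tripos)

theorem G_map₂ {φ ψ χ : K → Q.Val} {γ : K → P.Val}
    (h : Q.le (fun k => S.inf (φ k) (ψ k)) χ) (h₁ : P.le γ (fun k => L.G (φ k)))
    (h₂ : P.le γ (fun k => L.G (ψ k))) : P.le γ (fun k => L.G (χ k)) :=
  (L.adj _ _).1 (Q.le_trans (S.inf_intro ((L.adj _ _).2 h₁) ((L.adj _ _).2 h₂)) h)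

variable {I Y : Type u} {φ : I → Y → P.Val} {g : K → I} {γ : K → Q.Val}

/-- Left adjoints commute with existential quantification; this gives totality of transported
relations and compatibility with composition. -/
theorem F_some (h : Q.le γ (fun k => L.F (T.some φ (g k)))) :
    Q.le γ (fun k => S.some (fun i y => L.F (φ i y)) (g k)) := by
  refine Q.le_trans h (Q.le_reindex (φ := fun i => L.F (T.some φ i)) g ?_)
  refine (L.adj _ _).2 ((T.ex_le_iff _ _ _).2 ((L.adj _ _).1 ?_))
  exact S.some_intro (fun i y => L.F (φ i y)) (fun p : I × Y => p.1) (fun p => p.2)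
    (Q.le_refl _)

end Basic

/-! ### The functor between the represented toposes -/

section Functor

variable {P Q : IndexedPreorder.{u}} {T : P.Tripos} {u : P.Val}
  (L : NegNegReflection T Q u) (S : Q.Tripos) {A B C : Obj T}

/-- The action of a reflection on objects. -/
def obj (A : Obj T) : Obj S where
  X := A.X
  eq x y := L.F (A.eq x y)
  symm := L.F_mono A.symm
  trans := L.F_map₂ A.trans (S.inf_left (Q.le_refl _)) (S.inf_right (Q.le_refl _))

/-- The action of a reflection on functional relations. -/
def rel (R : FuncRel A B) : FuncRel (L.obj S A) (L.obj S B) where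
  rel x y := L.F (R.rel x y)
  strict := S.inf_intro (L.F_mono (R.left (P.le_refl _))) (L.F_mono (R.right (P.le_refl _)))
  congr := by
    have h := Q.le_refl (fun p : (A.X × A.X) × (B.X × B.X) =>
      S.inf (L.F (R.rel p.1.1 p.2.1))
        (S.inf (L.F (A.eq p.1.1 p.1.2)) (L.F (B.eq p.2.1 p.2.2))))
    exact L.F_map₂ R.congr (S.inf_left h) (L.F_map₂ (P.le_refl _) (S.inf_left (S.inf_right h))
      (S.inf_right (S.inf_right h)))
  single := L.F_map₂ R.single (S.inf_left (Q.le_refl _)) (S.inf_right (Q.le_refl _))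
  total := L.F_some S (g := fun x => x) (L.F_mono R.total)

/-- The functor between the represented toposes given by a reflection. -/
def functor : Obj T ⥤ Obj S where
  obj := L.obj S
  map := Quotient.map (L.rel S) (fun _ _ e => ⟨L.F_mono e.1, L.F_mono e.2⟩)
  map_id _ := rfl
  map_comp := by
    rintro A B C ⟨R⟩ ⟨R'⟩
    refine Quotient.sound (FuncRel.equiv_of_le ?_)
    have h := L.F_some S
      (φ := fun (p : A.X × C.X) (y : B.X) => T.inf (R.rel p.1 y) (R'.rel y p.2))
      (g := fun p : A.X × C.X => p) (Q.le_refl _)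
    refine S.some_cases h ?_
    intro δ _ h2
    exact FuncRel.compRel_intro (L.rel S R) (L.rel S R') (fun p => p.2)
      (Q.le_trans h2 (L.F_mono (T.inf_left (P.le_refl _))))
      (Q.le_trans h2 (L.F_mono (T.inf_right (P.le_refl _))))

theorem functor_map_hom (R : FuncRel A B) : (L.functor S).map R.hom = (L.rel S R).hom := rfl

end Functor

end NegNegReflection

namespace NegNegReflection

variable {P Q : IndexedPreorder.{u}} {T : P.Tripos} {u : P.Val}
  (L : NegNegReflection T Q u) (S : Q.Tripos) {A B C : Obj T}

/-! ### Separated objects -/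

/-- An object is separated if its equality predicate is closed. -/
def IsSeparated (B : Obj T) : Prop :=
  P.le (fun x : B.X × B.X =>
    T.inf (L.G (L.F (B.eq x.1 x.2))) (T.inf (B.eq x.1 x.1) (B.eq x.2 x.2)))
    (fun x => B.eq x.1 x.2)

variable {L}

theorem IsSeparated.eq (hB : L.IsSeparated B) {K : Type u} {γ : K → P.Val} {x y : K → B.X}
    (h : P.le γ (fun k => L.G (L.F (B.eq (x k) (y k)))))
    (hx : P.le γ (fun k => B.eq (x k) (x k))) (hy : P.le γ (fun k => B.eq (y k) (y k))) :
    P.le γ (fun k => B.eq (x k) (y k)) :=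
  P.le_trans (T.inf_intro h (T.inf_intro hx hy)) (P.le_reindex (fun k => (x k, y k)) hB)

/-- The value of `F` at `x` is a value of `G` up to closure, so it equals the actual value of `G` up
to closure. Separatedness removes the closure. -/
theorem IsSeparated.map_injective (hB : L.IsSeparated B) {f g : A ⟶ B}
    (e : (L.functor S).map f = (L.functor S).map g) : f = g := by
  obtain ⟨F, rfl⟩ := FuncRel.exists_hom f
  obtain ⟨G, rfl⟩ := FuncRel.exists_hom g
  replace e : L.rel S F ≈ L.rel S G := FuncRel.hom_eq_iff.1 e
  refine FuncRel.hom_eq_of_le ?_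
  have h := P.le_refl (fun p : A.X × B.X => F.rel p.1 p.2)
  refine T.some_cases (φ := G.rel) (g := fun p : A.X × B.X => p.1) (G.total' (F.left h)) ?_
  intro δ h1 h2
  have h3 : P.le δ (fun p => F.rel p.1.1 p.1.2) := h1
  have h4 : P.le δ (fun p => L.G (L.F (G.rel p.1.1 p.1.2))) :=
    P.le_trans h3 (P.le_reindex (fun p : (A.X × B.X) × B.X => p.1) ((L.adj _ _).1 e.1))
  refine G.congr' h2 (G.left h2) (hB.eq ?_ (G.right h2) (F.right h3))
  exact L.G_map₂ S ((L.rel S G).single' (S.inf_left (Q.le_refl _)) (S.inf_right (Q.le_refl _)))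
    (P.le_trans h2 (L.le_GF _)) h4

/-- The lift is `G H` cut down to existing elements. Its values agree only up to closure, so
separatedness makes it single-valued; `ht` is its totality, which does not follow from that of `H`
because the latter holds only up to closure. -/
theorem IsSeparated.exists_lift (hB : L.IsSeparated B)
    (H : FuncRel (L.obj S A) (L.obj S B))
    (ht : P.le (fun x : A.X => A.eq x x)
      (T.some (fun (x : A.X) (y : B.X) => T.inf (B.eq y y) (L.G (H.rel x y))))) :
    ∃ R : FuncRel A B, (L.functor S).map R.hom = H.hom := by
  let R : FuncRel A B :=
    { rel := fun x y => T.inf (A.eq x x) (T.inf (B.eq y y) (L.G (H.rel x y)))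
      strict := ?_
      congr := ?_
      single := ?_
      total := ?_ }
  · refine ⟨R, ?_⟩
    rw [functor_map_hom]
    refine FuncRel.hom_eq_of_le ?_
    exact Q.le_trans (L.F_mono (T.inf_right (T.inf_right (P.le_refl _)))) (L.FG_le _)
  · exact T.inf_intro (T.inf_left (P.le_refl _)) (T.inf_left (T.inf_right (P.le_refl _)))
  · have h := P.le_refl (fun p : (A.X × A.X) × (B.X × B.X) =>
      T.inf (T.inf (A.eq p.1.1 p.1.1) (T.inf (B.eq p.2.1 p.2.1) (L.G (H.rel p.1.1 p.2.1))))
        (T.inf (A.eq p.1.1 p.1.2) (B.eq p.2.1 p.2.2)))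
    have h1 := T.inf_left (T.inf_right h)
    have h2 := T.inf_right (T.inf_right h)
    refine T.inf_intro (A.refl_right h1) (T.inf_intro (B.refl_right h2) ?_)
    exact L.G_map₂ S H.congr (T.inf_right (T.inf_right (T.inf_left h)))
      (L.G_map₂ S (Q.le_refl _) (P.le_trans h1 (L.le_GF _)) (P.le_trans h2 (L.le_GF _)))
  · have h := P.le_refl (fun p : A.X × B.X × B.X =>
      T.inf (T.inf (A.eq p.1 p.1) (T.inf (B.eq p.2.1 p.2.1) (L.G (H.rel p.1 p.2.1))))
        (T.inf (A.eq p.1 p.1) (T.inf (B.eq p.2.2 p.2.2) (L.G (H.rel p.1 p.2.2)))))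
    have h1 := T.inf_right (T.inf_left h)
    have h2 := T.inf_right (T.inf_right h)
    exact hB.eq (L.G_map₂ S H.single (T.inf_right h1) (T.inf_right h2)) (T.inf_left h1)
      (T.inf_left h2)
  · refine T.some_cases
      (φ := fun (x : A.X) (y : B.X) => T.inf (B.eq y y) (L.G (H.rel x y)))
      (g := fun x => x) ht ?_
    intro δ h1 h2
    exact T.some_intro
      (fun (x : A.X) (y : B.X) => T.inf (A.eq x x) (T.inf (B.eq y y) (L.G (H.rel x y))))
      (fun p : A.X × B.X => p.1) (fun p => p.2) (T.inf_intro h1 h2)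

variable (L)

/-- `F` turns a double negation into truth, so surjectivity up to double negation becomes
surjectivity. With the two preceding results on dense monomorphisms, the functor inverts all of
them. -/
theorem isIso_map (R : FuncRel A B)
    (inj : P.le (fun p : A.X × A.X × B.X => T.inf (R.rel p.1 p.2.2) (R.rel p.2.1 p.2.2))
      (fun p => A.eq p.1 p.2.1))
    (surj : P.le (fun y : B.X => B.eq y y)
      (fun y => T.nn u (T.some (fun (y : B.X) (x : A.X) => R.rel x y) y))) :
    IsIso ((L.functor S).map R.hom) := by
  rw [functor_map_hom]
  refine FuncRel.isIso_hom _ ?_ ?_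
  · exact L.F_map₂ inj (S.inf_left (Q.le_refl _)) (S.inf_right (Q.le_refl _))
  · exact L.F_some S (φ := fun (y : B.X) (x : A.X) => R.rel x y) (g := fun y => y)
      ((L.adj _ _).2 (P.le_trans surj (L.nn_le_GF _)))

theorem isIso_map_incl {p : A.X → P.Val}
    (hp : P.le (fun x : A.X × A.X => T.inf (p x.1) (A.eq x.1 x.2)) (fun x => p x.2))
    (hd : P.le (fun x : A.X => A.eq x x) (fun x => T.nn u (p x))) :
    IsIso ((L.functor S).map (A.incl p hp).hom) := by
  refine L.isIso_map S _ ?_ ?_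
  · have h := P.le_refl (fun x : A.X × A.X × A.X =>
      T.inf ((A.incl p hp).rel x.1 x.2.2) ((A.incl p hp).rel x.2.1 x.2.2))
    have h1 := T.inf_left h
    exact A.sub_intro (A.trans' (FuncRel.ofFun_right h1)
      (A.symm' (FuncRel.ofFun_right (T.inf_right h)))) (A.sub_pred (FuncRel.ofFun_left h1))
  · refine T.nn_cases hd ?_
    intro δ h1 h2
    exact T.nn_intro (T.some_intro (fun (y x : A.X) => (A.incl p hp).rel x y) (fun x => x)
      (fun x => x) (T.inf_intro (T.inf_intro h1 h2) h1))

/-! ### Sheaves for double negation in the closed subtopos -/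

/-- Sheaves for double negation are separated. -/
theorem isSeparated_of_isLocal {B : ClosedSub T u}
    (hB : (doubleNegDense (ClosedSub T u)).isLocal B) : L.IsSeparated B.obj := by
  let D := B.obj.prod B.obj
  -- The closure of the diagonal of `B × B`. The diagonal `q` is dense in it, so the projections,
  -- which agree on `q`, agree on `p` because `B` is a sheaf.
  let p : D.X → P.Val := fun x => T.nn u (B.obj.eq x.1 x.2)
  have e_congr : ∀ {K : Type u} {γ : K → P.Val} {x y : K → D.X},
      P.le γ (fun k => D.eq (x k) (y k)) → P.le γ (fun k => B.obj.eq (x k).1 (x k).2) →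
      P.le γ (fun k => B.obj.eq (y k).1 (y k).2) := fun {K γ x y} h h' =>
    B.obj.trans' (B.obj.symm' (Obj.prod_fst h)) (B.obj.trans' h' (Obj.prod_snd h))
  have hp : P.le (fun x : D.X × D.X => T.inf (p x.1) (D.eq x.1 x.2)) (fun x => p x.2) := by
    refine T.nn_cases (T.inf_left (P.le_refl _)) ?_
    intro δ h1 h2
    exact T.nn_intro (e_congr (T.inf_right h1) h2)
  let q : D.X → P.Val := fun x => B.obj.eq x.1 x.2
  have hq : P.le (fun x : D.X × D.X => T.inf (q x.1) ((D.sub p hp).eq x.1 x.2))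
      (fun x => q x.2) :=
    e_congr (D.sub_eq (hp := hp) (T.inf_right (P.le_refl _))) (T.inf_left (P.le_refl _))
  have hA : (D.sub p hp).IsClosed u :=
    (B.isClosed.prod B.isClosed).sub (T.nn_of_bot (T.inf_left (P.le_refl _)))
  have hAq : P.le (fun x : D.X => T.inf u ((D.sub p hp).eq x x)) q := by
    have h := P.le_refl (fun x : D.X => T.inf u ((D.sub p hp).eq x x))
    have h1 := D.sub_eq (hp := hp) (T.inf_right h)
    exact B.isClosed.unique' (T.inf_left h) (Obj.prod_fst h1) (Obj.prod_snd h1)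
  have hd := doubleNegDense_incl hA (hp := hq) hAq (D.sub_pred (hp := hp) (P.le_refl _))
  let f₁ : FuncRel (D.sub p hp) B.obj := FuncRel.ofFun (fun x : D.X => x.1)
    (Obj.prod_fst (D.sub_eq (hp := hp) (P.le_refl _)))
  let f₂ : FuncRel (D.sub p hp) B.obj := FuncRel.ofFun (fun x : D.X => x.2)
    (Obj.prod_snd (D.sub_eq (hp := hp) (P.le_refl _)))
  have e : ((D.sub p hp).incl q hq).hom ≫ f₁.hom = ((D.sub p hp).incl q hq).hom ≫ f₂.hom := by
    rw [FuncRel.comp_hom, FuncRel.comp_hom]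
    refine FuncRel.hom_eq_of_le ?_
    have h := P.le_refl (fun x : D.X × B.obj.X =>
      (FuncRel.comp ((D.sub p hp).incl q hq) f₁).rel x.1 x.2)
    have h1 := (FuncRel.comp ((D.sub p hp).incl q hq) f₁).left h
    have h2 := FuncRel.ofFun_comp_right h
    exact FuncRel.ofFun_comp_intro h1 (FuncRel.ofFun_intro ((D.sub p hp).sub_eq h1)
      (B.obj.trans' (B.obj.symm' ((D.sub p hp).sub_pred (hp := hq) h1))
        (T.inf_right h2)))
  have e' : f₁.hom = f₂.hom := by
    have := (hB _ hd).1 (a₁ := (ObjectProperty.homMk f₁.hom : hA.mk' ⟶ B))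
      (a₂ := ObjectProperty.homMk f₂.hom) (ObjectProperty.hom_ext _ e)
    exact congrArg InducedCategory.Hom.hom this
  have h := P.le_refl (fun x : B.obj.X × B.obj.X =>
    T.inf (L.G (L.F (B.obj.eq x.1 x.2))) (T.inf (B.obj.eq x.1 x.1) (B.obj.eq x.2 x.2)))
  exact FuncRel.eq_of_ofFun_hom_eq e' (x := fun x : D.X => x)
    (D.sub_intro (hp := hp) (T.inf_right h) (P.le_trans (T.inf_left h) (L.GF_le_nn _)))

/-- The functor induced by a reflection is full on sheaves for double negation. -/
theorem exists_map_eq_of_isLocal {A B : ClosedSub T u}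
    (hB : (doubleNegDense (ClosedSub T u)).isLocal B)
    (H : FuncRel (L.obj S A.obj) (L.obj S B.obj)) :
    ∃ f : A.obj ⟶ B.obj, (L.functor S).map f = H.hom := by
  have hs := L.isSeparated_of_isLocal hB
  -- The part of `A` on which `H` has a value that exists in `B`. It is dense because `H` is total
  -- up to closure.
  let p : A.obj.X → P.Val :=
    T.some (fun x (y : B.obj.X) => T.inf (B.obj.eq y y) (L.G (H.rel x y)))
  have p_intro : ∀ {K : Type u} {γ : K → P.Val} {x : K → A.obj.X} {y : K → B.obj.X},
      P.le γ (fun k => B.obj.eq (y k) (y k)) → P.le γ (fun k => L.G (H.rel (x k) (y k))) →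
      P.le γ (fun k => p (x k)) := fun {K γ x y} h h' =>
    T.some_intro (fun x (y : B.obj.X) => T.inf (B.obj.eq y y) (L.G (H.rel x y))) x y
      (T.inf_intro h h')
  have hp : P.le (fun x : A.obj.X × A.obj.X => T.inf (p x.1) (A.obj.eq x.1 x.2))
      (fun x => p x.2) := by
    have h := P.le_refl (fun x : A.obj.X × A.obj.X => T.inf (p x.1) (A.obj.eq x.1 x.2))
    refine T.some_cases
      (φ := fun x (y : B.obj.X) => T.inf (B.obj.eq y y) (L.G (H.rel x y))) (T.inf_left h) ?_
    intro δ h1 h2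
    have h3 := P.weaken Prod.fst h1 (T.inf_right h)
    refine p_intro (T.inf_left h2) (L.G_map₂ S ?_ (T.inf_right h2) (P.le_trans h3 (L.le_GF _)))
    have h4 := Q.le_refl (fun x : (A.obj.X × A.obj.X) × B.obj.X =>
      S.inf (H.rel x.1.1 x.2) (L.F (A.obj.eq x.1.1 x.1.2)))
    exact H.congr' (S.inf_left h4) (S.inf_right h4) (H.right (S.inf_left h4))
  have hu : P.le (fun x : A.obj.X => T.inf u (A.obj.eq x x)) p := by
    refine T.some_cases (φ := fun (_ : PUnit.{u + 1}) (x : B.obj.X) => B.obj.eq x x)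
      (g := fun _ => PUnit.unit) (B.isClosed.inhabited' (T.inf_left (P.le_refl _))) ?_
    intro δ h1 h2
    -- To the extent `u` any element of `B` is a value of `H`.
    exact p_intro h2 (L.le_G_of_bot (T.inf_left h1) _)
  have hd : P.le (fun x : A.obj.X => A.obj.eq x x) (fun x => T.nn u (p x)) := by
    refine P.le_trans ((L.adj _ _).1 ?_) (L.GF_le_nn p)
    refine S.some_cases (φ := H.rel) (g := fun x : A.obj.X => x) H.total ?_
    intro δ _ h2
    refine L.F_map₂ ?_ (H.right h2) (Q.le_trans h2 (L.le_FG _))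
    exact p_intro (T.inf_left (P.le_refl _)) (T.inf_right (P.le_refl _))
  let i := A.obj.incl p hp
  have : IsIso ((L.functor S).map i.hom) := L.isIso_map_incl S hp hd
  -- On the dense part the existence of values is built in, so the restriction of `H` lifts.
  obtain ⟨R, hR⟩ := hs.exists_lift S (FuncRel.comp (L.rel S i) H) (by
    have h := P.le_refl (fun x : A.obj.X => (A.obj.sub p hp).eq x x)
    refine T.some_cases
      (φ := fun x (y : B.obj.X) => T.inf (B.obj.eq y y) (L.G (H.rel x y)))
      (A.obj.sub_pred (hp := hp) h) ?_
    intro δ h1 h2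
    refine T.some_intro (fun (x : (A.obj.sub p hp).X) (y : B.obj.X) =>
        T.inf (B.obj.eq y y) (L.G ((FuncRel.comp (L.rel S i) H).rel x y)))
      (fun x : A.obj.X × B.obj.X => x.1) (fun x => x.2) (T.inf_intro (T.inf_left h2) ?_)
    have h3 : P.le δ (fun x => (A.obj.incl p hp).rel x.1 x.1) := FuncRel.ofFun_self h1
    refine L.G_map₂ S ?_ (P.le_trans h3 (L.le_GF _)) (T.inf_right h2)
    exact FuncRel.compRel_intro (L.rel S i) H (fun x : A.obj.X × B.obj.X => x.1)
      (S.inf_left (Q.le_refl _)) (S.inf_right (Q.le_refl _)))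
  obtain ⟨f, hf⟩ := (hB _ (doubleNegDense_incl A.isClosed (hp := hp) hu hd)).2
    (ObjectProperty.homMk R.hom)
  obtain ⟨f, rfl⟩ := ObjectProperty.homMk_surjective f
  change A.obj ⟶ B.obj at f
  have hf' : i.hom ≫ f = R.hom := congrArg InducedCategory.Hom.hom hf
  -- The extension `f` lies over `H` because the two agree after composition with the image of `i`,
  -- an isomorphism.
  refine ⟨f, (cancel_epi ((L.functor S).map i.hom)).1 ?_⟩
  exact ((L.functor S).map_comp i.hom f).symm.trans
    ((congrArg (L.functor S).map hf').trans hR)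

end NegNegReflection

/-! ### Singletons -/

section Singletons

variable {Q : IndexedPreorder.{u}} {S : Q.Tripos} (Y : Obj S)

/-- The predicate expressing that `σ` is the equivalence class of `y`. -/
def Obj.isClass (y : Y.X) (σ : Y.X → Q.Val) : Q.Val :=
  S.inf (Y.eq y y) (S.every (fun (p : Y.X × (Y.X → Q.Val)) z =>
    S.inf (S.himp (p.2 z) (Y.eq p.1 z)) (S.himp (Y.eq p.1 z) (p.2 z))) (y, σ))

variable {Y} {K : Type u} {γ : K → Q.Val} {y z : K → Y.X} {σ : K → Y.X → Q.Val}

theorem Obj.isClass_intro (h : Q.le γ (fun k => Y.eq (y k) (y k)))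
    (h₁ : ∀ δ : K × Y.X → Q.Val, Q.le δ (fun p => γ p.1) → Q.le δ (fun p => σ p.1 p.2) →
      Q.le δ (fun p => Y.eq (y p.1) p.2))
    (h₂ : ∀ δ : K × Y.X → Q.Val, Q.le δ (fun p => γ p.1) →
      Q.le δ (fun p => Y.eq (y p.1) p.2) → Q.le δ (fun p => σ p.1 p.2)) :
    Q.le γ (fun k => Y.isClass (y k) (σ k)) :=
  S.inf_intro h (S.every_intro
    (φ := fun (p : Y.X × (Y.X → Q.Val)) z =>
      S.inf (S.himp (p.2 z) (Y.eq p.1 z)) (S.himp (Y.eq p.1 z) (p.2 z)))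
    (g := fun k => (y k, σ k)) (S.inf_intro (S.himp_intro h₁) (S.himp_intro h₂)))

theorem Obj.isClass_refl (h : Q.le γ (fun k => Y.isClass (y k) (σ k))) :
    Q.le γ (fun k => Y.eq (y k) (y k)) :=
  S.inf_left h

theorem Obj.isClass_eq (h : Q.le γ (fun k => Y.isClass (y k) (σ k)))
    (hz : Q.le γ (fun k => σ k (z k))) : Q.le γ (fun k => Y.eq (y k) (z k)) :=
  S.himp_elim (S.inf_left (S.every_elim
    (φ := fun (p : Y.X × (Y.X → Q.Val)) z =>
      S.inf (S.himp (p.2 z) (Y.eq p.1 z)) (S.himp (Y.eq p.1 z) (p.2 z)))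
    (g := fun k => (y k, σ k)) (S.inf_right h) z)) hz

theorem Obj.isClass_mem (h : Q.le γ (fun k => Y.isClass (y k) (σ k)))
    (hz : Q.le γ (fun k => Y.eq (y k) (z k))) : Q.le γ (fun k => σ k (z k)) :=
  S.himp_elim (S.inf_right (S.every_elim
    (φ := fun (p : Y.X × (Y.X → Q.Val)) z =>
      S.inf (S.himp (p.2 z) (Y.eq p.1 z)) (S.himp (Y.eq p.1 z) (p.2 z)))
    (g := fun k => (y k, σ k)) (S.inf_right h) z)) hz

theorem Obj.isClass_congr (h : Q.le γ (fun k => Y.isClass (y k) (σ k)))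
    (hz : Q.le γ (fun k => Y.eq (y k) (z k))) : Q.le γ (fun k => Y.isClass (z k) (σ k)) := by
  refine isClass_intro (Y.refl_right hz) ?_ ?_
  · intro δ h1 h2
    exact Y.trans' (Y.symm' (Q.weaken Prod.fst h1 hz))
      (isClass_eq (Q.weaken Prod.fst h1 h) h2)
  · intro δ h1 h2
    exact isClass_mem (Q.weaken Prod.fst h1 h) (Y.trans' (Q.weaken Prod.fst h1 hz) h2)

theorem Obj.isClass_inj (h : Q.le γ (fun k => Y.isClass (y k) (σ k)))
    (hz : Q.le γ (fun k => Y.isClass (z k) (σ k))) : Q.le γ (fun k => Y.eq (y k) (z k)) :=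
  isClass_eq h (isClass_mem hz (isClass_refl hz))

/-- The function `x ↦ R.rel x` thus picks the singleton of the value at `x` without any existential
quantifier. -/
theorem FuncRel.isClass_rel {X : Obj S} (R : FuncRel X Y) {x : K → X.X}
    (h : Q.le γ (fun k => R.rel (x k) (y k))) :
    Q.le γ (fun k => Y.isClass (y k) (R.rel (x k))) := by
  refine Obj.isClass_intro (R.right h) ?_ ?_
  · intro δ h1 h2
    exact R.single' (Q.weaken Prod.fst h1 h) h2
  · intro δ h1 h2
    have h3 := Q.weaken Prod.fst h1 h
    exact R.congr' h3 (R.left h3) h2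

variable (Y)

/-- The predicate expressing that `σ` and `τ` are equivalence classes of the same element. -/
def Obj.sameClass (σ τ : Y.X → Q.Val) : Q.Val :=
  S.some (fun (p : (Y.X → Q.Val) × (Y.X → Q.Val)) y =>
    S.inf (Y.isClass y p.1) (Y.isClass y p.2)) (σ, τ)

variable {Y} {τ : K → Y.X → Q.Val}

theorem Obj.sameClass_intro (h : Q.le γ (fun k => Y.isClass (y k) (σ k)))
    (h' : Q.le γ (fun k => Y.isClass (y k) (τ k))) :
    Q.le γ (fun k => Y.sameClass (σ k) (τ k)) :=
  S.some_intro (fun (p : (Y.X → Q.Val) × (Y.X → Q.Val)) y =>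
    S.inf (Y.isClass y p.1) (Y.isClass y p.2)) (fun k => (σ k, τ k)) y (S.inf_intro h h')

theorem Obj.sameClass_cases {χ : K → Q.Val} (h : Q.le γ (fun k => Y.sameClass (σ k) (τ k)))
    (h' : ∀ δ : K × Y.X → Q.Val, Q.le δ (fun p => γ p.1) →
      Q.le δ (fun p => Y.isClass p.2 (σ p.1)) → Q.le δ (fun p => Y.isClass p.2 (τ p.1)) →
      Q.le δ (fun p => χ p.1)) : Q.le γ χ :=
  S.some_cases (φ := fun (p : (Y.X → Q.Val) × (Y.X → Q.Val)) y =>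
    S.inf (Y.isClass y p.1) (Y.isClass y p.2)) (g := fun k => (σ k, τ k)) h
    (fun δ h1 h2 => h' δ h1 (S.inf_left h2) (S.inf_right h2))

theorem Obj.isClass_of_sameClass (h : Q.le γ (fun k => Y.sameClass (σ k) (τ k)))
    (h' : Q.le γ (fun k => Y.isClass (y k) (σ k))) :
    Q.le γ (fun k => Y.isClass (y k) (τ k)) := by
  refine sameClass_cases h ?_
  intro δ h1 h2 h3
  exact isClass_congr h3 (isClass_inj h2 (Q.weaken Prod.fst h1 h'))

end Singletons

/-! ### The sheaf of singletons and the equivalence of toposes -/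

namespace NegNegReflection

variable {P Q : IndexedPreorder.{u}} {T : P.Tripos} {u : P.Val}
  (L : NegNegReflection T Q u) {S : Q.Tripos} {A B C : Obj T} (Y : Obj S)

/-- The object of singletons of `Y`, transported along a reflection. -/
def singletons : Obj T where
  X := Y.X → Q.Val
  eq σ τ := L.G (Y.sameClass σ τ)
  symm := L.G_mono (Obj.sameClass_cases (Q.le_refl _)
    (fun _ _ h1 h2 => Obj.sameClass_intro h2 h1))
  trans := by
    refine L.G_map₂ S (γ := fun p : (Y.X → Q.Val) × (Y.X → Q.Val) × (Y.X → Q.Val) =>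
      T.inf (L.G (Y.sameClass p.1 p.2.1)) (L.G (Y.sameClass p.2.1 p.2.2))) ?_
      (T.inf_left (P.le_refl _)) (T.inf_right (P.le_refl _))
    refine Obj.sameClass_cases (S.inf_left (Q.le_refl _)) ?_
    intro δ h1 h2 h3
    exact Obj.sameClass_intro h2 (Obj.isClass_of_sameClass (S.inf_right h1) h3)

theorem isClosed_singletons : (L.singletons Y).IsClosed u where
  inhabited := T.some_intro
    (fun (_ : PUnit.{u + 1}) (x : (L.singletons Y).X) => (L.singletons Y).eq x x)
    -- Any predicate would do: to the extent `u` every value of `G` holds.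
    (fun x => x) (fun _ _ => S.top) (L.le_G_of_bot (P.le_refl _) _)
  unique := L.le_G_of_bot (T.inf_left (P.le_refl _)) _

theorem isSeparated_singletons : L.IsSeparated (L.singletons Y) :=
  P.le_trans (T.inf_left (P.le_refl _)) (L.G_mono (L.FG_le _))

/-- The functional relation which sends an element to its equivalence class. -/
def toSingletons : FuncRel Y (L.obj S (L.singletons Y)) where
  rel y σ := Y.isClass y σ
  strict := by
    have h := Q.le_refl (fun p : Y.X × (Y.X → Q.Val) => Y.isClass p.1 p.2)
    exact S.inf_intro (Obj.isClass_refl h) (Q.le_trans (Obj.sameClass_intro h h) (L.le_FG _))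
  congr := by
    have h := Q.le_refl (fun p : (Y.X × Y.X) × ((Y.X → Q.Val) × (Y.X → Q.Val)) =>
      S.inf (Y.isClass p.1.1 p.2.1) (S.inf (Y.eq p.1.1 p.1.2)
        (L.F (L.G (Y.sameClass p.2.1 p.2.2)))))
    exact Obj.isClass_of_sameClass (Q.le_trans (S.inf_right (S.inf_right h)) (L.FG_le _))
      (Obj.isClass_congr (S.inf_left h) (S.inf_left (S.inf_right h)))
  single := Q.le_trans (Obj.sameClass_intro (S.inf_left (Q.le_refl _))
    (S.inf_right (Q.le_refl _))) (L.le_FG _)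
  total := S.some_intro (fun y σ => Y.isClass y σ) (fun y => y) Y.eq
    ((FuncRel.id Y).isClass_rel (x := fun y => y) (Q.le_refl _))

instance isIso_toSingletons : IsIso (L.toSingletons Y).hom := by
  refine FuncRel.isIso_hom _ ?_ ?_
  · exact Obj.isClass_inj (S.inf_left (Q.le_refl _)) (S.inf_right (Q.le_refl _))
  · refine Obj.sameClass_cases (L.FG_le (fun σ : Y.X → Q.Val => Y.sameClass σ σ)) ?_
    intro δ h1 h2 _
    exact S.some_intro (fun (σ : Y.X → Q.Val) y => Y.isClass y σ)
      (fun p : (Y.X → Q.Val) × Y.X => p.1) (fun p => p.2) h2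

/-- Transport `h` to a relation `M` from `A` to `Y`. The actual function `x ↦ M.rel x` selects the
value of the lift, so totality holds at once and no passage to a dense subobject of `A` is needed.
-/
theorem exists_map_eq_singletons
    (h : L.obj S A ⟶ L.obj S (L.singletons Y)) :
    ∃ f : A ⟶ L.singletons Y, (L.functor S).map f = h := by
  obtain ⟨M, hM⟩ := FuncRel.exists_hom (h ≫ inv (L.toSingletons Y).hom)
  obtain ⟨R, hR⟩ := (L.isSeparated_singletons Y).exists_lift S
    (FuncRel.comp M (L.toSingletons Y)) (A := A) (by
      have h1 : P.le (fun x : A.X => A.eq x x)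
          (fun x => L.G ((FuncRel.comp M (L.toSingletons Y)).rel x (M.rel x))) := by
        refine (L.adj _ _).1 ?_
        refine S.some_cases (φ := M.rel) (g := fun x : A.X => x) M.total ?_
        intro δ _ h1
        exact FuncRel.compRel_intro M (L.toSingletons Y) (fun p : A.X × Y.X => p.2) h1
          (M.isClass_rel h1)
      have h2 : P.le (fun x : A.X => A.eq x x)
          (fun x => (L.singletons Y).eq (M.rel x) (M.rel x)) :=
        P.le_trans h1 (P.le_trans (L.G_mono ((FuncRel.comp M (L.toSingletons Y)).right
          (Q.le_refl _))) (L.G_mono (L.FG_le _)))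
      exact T.some_intro (fun (x : A.X) (σ : (L.singletons Y).X) =>
        T.inf ((L.singletons Y).eq σ σ)
          (L.G ((FuncRel.comp M (L.toSingletons Y)).rel x σ))) (fun x => x) M.rel
        (T.inf_intro h2 h1))
  refine ⟨R.hom, hR.trans ?_⟩
  rw [← FuncRel.comp_hom, hM, Category.assoc, IsIso.inv_hom_id]
  exact Category.comp_id h

/-- The functor is bijective on morphisms into the object of singletons and inverts dense
monomorphisms, so extension along them is unique and always possible. -/
theorem isLocal_singletons :
    (doubleNegDense (ClosedSub T u)).isLocal (L.isClosed_singletons Y).mk' := by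
  intro A B m hm
  obtain ⟨m, rfl⟩ := ObjectProperty.homMk_surjective m
  obtain ⟨R, rfl⟩ := FuncRel.exists_hom m
  have : IsIso ((L.functor S).map R.hom) :=
    L.isIso_map S R (R.injective_of_mono A.isClosed B.isClosed hm.1)
      (R.nn_surjective_of_doubleNegDense A.isClosed B.isClosed hm)
  constructor
  · intro f g e
    obtain ⟨f, rfl⟩ := ObjectProperty.homMk_surjective f
    obtain ⟨g, rfl⟩ := ObjectProperty.homMk_surjective g
    change B.obj ⟶ L.singletons Y at f g
    have e' : R.hom ≫ f = R.hom ≫ g := congrArg InducedCategory.Hom.hom e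
    have e'' : (L.functor S).map R.hom ≫ (L.functor S).map f =
        (L.functor S).map R.hom ≫ (L.functor S).map g :=
      ((L.functor S).map_comp _ _).symm.trans
        ((congrArg (L.functor S).map e').trans ((L.functor S).map_comp _ _))
    exact congrArg ObjectProperty.homMk
      ((L.isSeparated_singletons Y).map_injective S ((cancel_epi _).1 e''))
  · intro g
    obtain ⟨h, hh⟩ : ∃ h, (L.functor S).map R.hom ≫ h = (L.functor S).map g.hom :=
      ⟨_, IsIso.hom_inv_id_assoc _ _⟩
    obtain ⟨f, rfl⟩ := L.exists_map_eq_singletons Y h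
    refine ⟨ObjectProperty.homMk f,
      ObjectProperty.hom_ext _ ((L.isSeparated_singletons Y).map_injective S ?_)⟩
    exact ((L.functor S).map_comp R.hom f).trans hh

variable (S)

/-- The functor from sheaves for double negation in the closed subtopos to the topos represented
by the reflection. -/
def sheafFunctor : Booleanization (ClosedSub T u) ⥤ Obj S :=
  ObjectProperty.ι _ ⋙ ObjectProperty.ι _ ⋙ L.functor S

instance : (L.sheafFunctor S).Faithful where
  map_injective {_ B _ _} e := ObjectProperty.hom_ext _ (ObjectProperty.hom_ext _
    ((L.isSeparated_of_isLocal B.property).map_injective S e))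

instance : (L.sheafFunctor S).Full where
  map_surjective {A B} h := by
    obtain ⟨H, rfl⟩ := FuncRel.exists_hom (A := L.obj S A.obj.obj) (B := L.obj S B.obj.obj) h
    obtain ⟨f, hf⟩ := L.exists_map_eq_of_isLocal S (A := A.obj) B.property H
    exact ⟨ObjectProperty.homMk (ObjectProperty.homMk f), hf⟩

instance : (L.sheafFunctor S).EssSurj where
  mem_essImage Y := ⟨⟨(L.isClosed_singletons Y).mk', L.isLocal_singletons Y⟩,
    ⟨(asIso (L.toSingletons Y).hom).symm⟩⟩

/-- The topos represented by the reflection is the Booleanization of the closed subtopos. -/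
theorem nonempty_equivalence (L : NegNegReflection T Q u) :
    Nonempty (Obj S ≌ Booleanization (ClosedSub T u)) :=
  have : (L.sheafFunctor S).IsEquivalence := {}
  ⟨(L.sheafFunctor S).asEquivalence.symm⟩

end NegNegReflection

end Tripos

end IndexedPreorder

namespace AKS

variable {𝒦 : AKS.{u}}

local infixl:75 " ⬝ " => AKS.bullet

/-! ### Combinatory completeness -/

/-- The filter of closed sets of stacks which are realized by a quasi-proof. -/
abbrev Filter (𝒦 : AKS.{u}) : Set 𝒦.ClosedSet := 𝒦.filteredOPCA.filter

theorem bullet_mem_filter {a b : 𝒦.ClosedSet} (ha : a ∈ 𝒦.Filter) (hb : b ∈ 𝒦.Filter) :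
    a ⬝ b ∈ 𝒦.Filter :=
  𝒦.filteredOPCA.app_mem a ha b hb _ (Part.mem_some _)

theorem ofTerm_mem_filter {t : 𝒦.Term} (ht : t ∈ 𝒦.QP) : ofTerm t ∈ 𝒦.Filter :=
  ⟨t, mem_orthTerms_ofTerm t, ht⟩

theorem K_bullet_le (a b : 𝒦.ClosedSet) : ofTerm 𝒦.K ⬝ a ⬝ b ≤ a := by
  obtain ⟨_, h₁, _, h₂, h⟩ := isK_ofTerm (𝒦 := 𝒦) a b
  obtain rfl := Part.mem_some_iff.1 h₁
  obtain rfl := Part.mem_some_iff.1 h₂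
  exact h

theorem S_bullet_le (a b c : 𝒦.ClosedSet) : ofTerm 𝒦.S ⬝ a ⬝ b ⬝ c ≤ a ⬝ c ⬝ (b ⬝ c) := by
  obtain ⟨_, h₁, _, h₂, _, h₃, h⟩ := isS_ofTerm (𝒦 := 𝒦) a b c _ _ _ (Part.mem_some _)
    (Part.mem_some _) (Part.mem_some _)
  obtain rfl := Part.mem_some_iff.1 h₁
  obtain rfl := Part.mem_some_iff.1 h₂
  obtain rfl := Part.mem_some_iff.1 h₃
  exact h

/-- CombPolynomials over the filter. -/
inductive CombPoly (𝒦 : AKS.{u}) : Type u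
  | cst (a : 𝒦.ClosedSet) (ha : a ∈ 𝒦.Filter) : CombPoly 𝒦
  | var (n : ℕ) : CombPoly 𝒦
  | ap (p q : CombPoly 𝒦) : CombPoly 𝒦

namespace CombPoly

/-- The value of a polynomial; missing variables are interpreted by the combinator `k`. -/
def eval (l : List 𝒦.ClosedSet) : CombPoly 𝒦 → 𝒦.ClosedSet
  | cst a _ => a
  | var n => l.getD n (ofTerm 𝒦.K)
  | ap p q => p.eval l ⬝ q.eval l

/-- The constant `k`. -/
def constK (𝒦 : AKS.{u}) : CombPoly 𝒦 := cst (ofTerm 𝒦.K) (ofTerm_mem_filter 𝒦.K_mem)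

/-- The constant `s`. -/
def constS (𝒦 : AKS.{u}) : CombPoly 𝒦 := cst (ofTerm 𝒦.S) (ofTerm_mem_filter 𝒦.S_mem)

/-- Bracket abstraction of the variable `0`. -/
def abs : CombPoly 𝒦 → CombPoly 𝒦
  | cst a ha => ap (constK 𝒦) (cst a ha)
  | var 0 => ap (ap (constS 𝒦) (constK 𝒦)) (constK 𝒦)
  | var (n + 1) => ap (constK 𝒦) (var n)
  | ap p q => ap (ap (constS 𝒦) p.abs) q.abs

/-- Beta reduction, as an inequality. It holds without provisos on definedness because application
is total here. -/
theorem eval_abs_le (l : List 𝒦.ClosedSet) (x : 𝒦.ClosedSet) :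
    ∀ p : CombPoly 𝒦, p.abs.eval l ⬝ x ≤ p.eval (x :: l)
  | cst _ _ => K_bullet_le _ _
  | var 0 => (S_bullet_le _ _ _).trans (K_bullet_le _ _)
  | var (_ + 1) => K_bullet_le _ _
  | ap p q => (S_bullet_le _ _ _).trans (bullet_mono (eval_abs_le l x p) (eval_abs_le l x q))

theorem eval_nil_mem : ∀ p : CombPoly 𝒦, p.eval [] ∈ 𝒦.Filter
  | cst _ ha => ha
  | var _ => ofTerm_mem_filter 𝒦.K_mem
  | ap p q => bullet_mem_filter p.eval_nil_mem q.eval_nil_mem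

theorem exists_one (p : CombPoly 𝒦) : ∃ e ∈ 𝒦.Filter, ∀ x, e ⬝ x ≤ p.eval [x] :=
  ⟨_, p.abs.eval_nil_mem, fun x => p.eval_abs_le [] x⟩

/-- The environment lists the last argument first: `var 0` is `y` and `var 1` is `x`. -/
theorem exists_two (p : CombPoly 𝒦) : ∃ e ∈ 𝒦.Filter, ∀ x y, e ⬝ x ⬝ y ≤ p.eval [y, x] := by
  obtain ⟨e, he, h⟩ := p.abs.exists_one
  exact ⟨e, he, fun x y => (bullet_mono (h x) le_rfl).trans (p.eval_abs_le [x] y)⟩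

theorem exists_three (p : CombPoly 𝒦) :
    ∃ e ∈ 𝒦.Filter, ∀ x y z, e ⬝ x ⬝ y ⬝ z ≤ p.eval [z, y, x] := by
  obtain ⟨e, he, h⟩ := p.abs.exists_two
  exact ⟨e, he, fun x y z => (bullet_mono (h x y) le_rfl).trans (p.eval_abs_le [y, x] z)⟩

end CombPoly

open CombPoly

theorem exists_id (𝒦 : AKS.{u}) : ∃ e ∈ 𝒦.Filter, ∀ x, e ⬝ x ≤ x :=
  exists_one (var 0)

theorem exists_snd (𝒦 : AKS.{u}) : ∃ e ∈ 𝒦.Filter, ∀ x y, e ⬝ x ⬝ y ≤ y :=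
  exists_two (var 0)

theorem exists_pair (𝒦 : AKS.{u}) :
    ∃ e ∈ 𝒦.Filter, ∀ x y z, e ⬝ x ⬝ y ⬝ z ≤ z ⬝ x ⬝ y :=
  exists_three (ap (ap (var 0) (var 2)) (var 1))

/-! ### The tripos of downsets -/

theorem krivineTripos_le_iff {I : Type u} {φ ψ : I → 𝒦.ClosedSet} :
    𝒦.krivineTripos.le φ ψ ↔ ∃ e ∈ 𝒦.Filter, ∀ i, e ⬝ φ i ≤ ψ i := by
  constructor
  · rintro ⟨_, ⟨e, he, rfl⟩, h⟩
    refine ⟨e, he, fun i => ?_⟩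
    obtain ⟨b, hb, hle⟩ := h i
    obtain rfl := Part.mem_some_iff.1 hb
    exact hle
  · rintro ⟨e, he, h⟩
    exact ⟨_, ⟨e, he, rfl⟩, fun i => ⟨_, Part.mem_some _, h i⟩⟩

theorem downIndexed_le_iff {I : Type u} {φ ψ : I → LowerSet 𝒦.ClosedSet} :
    𝒦.filteredOPCA.downIndexed.le φ ψ ↔
      ∃ e ∈ 𝒦.Filter, ∀ i, ∀ a ∈ φ i, e ⬝ a ∈ ψ i := by
  constructor
  · rintro ⟨_, ⟨_, ⟨e, he, rfl⟩, rfl⟩, h⟩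
    refine ⟨e, he, fun i a ha => ?_⟩
    obtain ⟨b, hb, hle⟩ := h i
    obtain ⟨-, rfl⟩ := BCO.mem_downMap.1 hb
    exact hle (subset_lowerClosure ⟨a, ha, Part.mem_some _⟩)
  · rintro ⟨e, he, h⟩
    refine ⟨_, ⟨_, ⟨e, he, rfl⟩, rfl⟩, fun i =>
      ⟨_, BCO.mem_downMap.2 ⟨fun _ _ => trivial, rfl⟩, ?_⟩⟩
    refine lowerClosure_le.2 ?_
    rintro b ⟨a, ha, hb⟩
    obtain rfl := Part.mem_some_iff.1 hb
    exact h i a ha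

theorem downIndexed_le_of_subset {I : Type u} {φ ψ : I → LowerSet 𝒦.ClosedSet}
    (h : ∀ i, ∀ a ∈ φ i, a ∈ ψ i) : 𝒦.filteredOPCA.downIndexed.le φ ψ := by
  obtain ⟨e, he, h'⟩ := exists_id 𝒦
  exact downIndexed_le_iff.2 ⟨e, he, fun i a ha => (ψ i).lower (h' a) (h i a ha)⟩

theorem mem_imp_iff {V W : LowerSet 𝒦.ClosedSet} {a : 𝒦.ClosedSet} :
    a ∈ 𝒦.filteredOPCA.imp V W ↔ ∀ b ∈ V, a ⬝ b ∈ W := by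
  constructor
  · intro h b hb
    obtain ⟨r, hr, hW⟩ := h b hb
    obtain rfl := Part.mem_some_iff.1 hr
    exact hW
  · exact fun h b hb => ⟨_, Part.mem_some _, h b hb⟩

/-- The second projection combinator. -/
noncomputable def kbar (𝒦 : AKS.{u}) : 𝒦.ClosedSet := (exists_snd 𝒦).choose

theorem kbar_mem : kbar 𝒦 ∈ 𝒦.Filter := (exists_snd 𝒦).choose_spec.1

theorem kbar_bullet_le (a b : 𝒦.ClosedSet) : kbar 𝒦 ⬝ a ⬝ b ≤ b :=
  (exists_snd 𝒦).choose_spec.2 a b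

/-- The downset of pairs. -/
def pairs (V W : LowerSet 𝒦.ClosedSet) : LowerSet 𝒦.ClosedSet where
  carrier := {c | c ⬝ ofTerm 𝒦.K ∈ V ∧ c ⬝ kbar 𝒦 ∈ W}
  lower' _ _ hle h := ⟨V.lower (bullet_mono hle le_rfl) h.1, W.lower (bullet_mono hle le_rfl) h.2⟩

/-- The downset of tagged elements. -/
def tagged (V W : LowerSet 𝒦.ClosedSet) : LowerSet 𝒦.ClosedSet where
  carrier := {c | (c ⬝ ofTerm 𝒦.K ≤ ofTerm 𝒦.K ∧ c ⬝ kbar 𝒦 ∈ V) ∨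
    (c ⬝ ofTerm 𝒦.K ≤ kbar 𝒦 ∧ c ⬝ kbar 𝒦 ∈ W)}
  lower' _ _ hle h := h.imp
    (fun h => ⟨(bullet_mono hle le_rfl).trans h.1, V.lower (bullet_mono hle le_rfl) h.2⟩)
    (fun h => ⟨(bullet_mono hle le_rfl).trans h.1, W.lower (bullet_mono hle le_rfl) h.2⟩)

/-- The downset of elements of members of a family over a given index. -/
def union {I J : Type u} (f : I → J) (φ : I → LowerSet 𝒦.ClosedSet) (j : J) :
    LowerSet 𝒦.ClosedSet where
  carrier := {c | ∃ i, f i = j ∧ c ∈ φ i}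
  lower' := fun _ _ hle ⟨i, hi, hc⟩ => ⟨i, hi, (φ i).lower hle hc⟩

/-- The downset of common elements of the members of a family over a given index. -/
def inter {I J : Type u} (f : I → J) (φ : I → LowerSet 𝒦.ClosedSet) (j : J) :
    LowerSet 𝒦.ClosedSet where
  carrier := {c | ∀ i, f i = j → c ∈ φ i}
  lower' := fun _ _ hle h i hi => (φ i).lower hle (h i hi)

/-- Entailment of families of downsets. -/
def Entails {I : Type u} (φ ψ : I → LowerSet 𝒦.ClosedSet) : Prop :=
  ∃ e ∈ 𝒦.Filter, ∀ i, ∀ a ∈ φ i, e ⬝ a ∈ ψ i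

section Entails

variable {I J : Type u} (φ ψ χ : I → LowerSet 𝒦.ClosedSet)

/-- Any `c` counts as a pair whose values at `k` and `kbar` lie in the components; the pairing
combinator produces such elements. -/
theorem entails_pairs_iff :
    Entails χ (fun i => pairs (φ i) (ψ i)) ↔ Entails χ φ ∧ Entails χ ψ := by
  constructor
  · rintro ⟨e, he, h⟩
    obtain ⟨e₁, he₁, h₁⟩ := exists_one (ap (ap (cst e he) (var 0)) (constK 𝒦))
    obtain ⟨e₂, he₂, h₂⟩ := exists_one (ap (ap (cst e he) (var 0)) (cst _ kbar_mem))
    exact ⟨⟨e₁, he₁, fun i a ha => (φ i).lower (h₁ a) (h i a ha).1⟩,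
      ⟨e₂, he₂, fun i a ha => (ψ i).lower (h₂ a) (h i a ha).2⟩⟩
  · rintro ⟨⟨e₁, he₁, h₁⟩, ⟨e₂, he₂, h₂⟩⟩
    obtain ⟨p, hp, hp'⟩ := exists_pair 𝒦
    obtain ⟨e, he, h⟩ := exists_one (ap (ap (cst p hp) (ap (cst e₁ he₁) (var 0)))
      (ap (cst e₂ he₂) (var 0)))
    refine ⟨e, he, fun i a ha => ⟨(φ i).lower ?_ (h₁ i a ha), (ψ i).lower ?_ (h₂ i a ha)⟩⟩
    · exact (bullet_mono (h a) le_rfl).trans ((hp' _ _ _).trans (K_bullet_le _ _))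
    · exact (bullet_mono (h a) le_rfl).trans ((hp' _ _ _).trans (kbar_bullet_le _ _))

/-- The tag `c k` is itself a projection, so applied to `e₁` and `e₂` it selects the realizer to be
applied to the content `c kbar`. -/
theorem tagged_entails_iff :
    Entails (fun i => tagged (φ i) (ψ i)) χ ↔ Entails φ χ ∧ Entails ψ χ := by
  constructor
  · rintro ⟨e, he, h⟩
    obtain ⟨p, hp, hp'⟩ := exists_pair 𝒦
    obtain ⟨e₁, he₁, h₁⟩ := exists_one (ap (cst e he) (ap (ap (cst p hp) (constK 𝒦)) (var 0)))
    obtain ⟨e₂, he₂, h₂⟩ := exists_one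
      (ap (cst e he) (ap (ap (cst p hp) (cst _ kbar_mem)) (var 0)))
    refine ⟨⟨e₁, he₁, fun i a ha => (χ i).lower (h₁ a) (h i _ (Or.inl ⟨?_, ?_⟩))⟩,
      ⟨e₂, he₂, fun i a ha => (χ i).lower (h₂ a) (h i _ (Or.inr ⟨?_, ?_⟩))⟩⟩
    · exact (hp' _ _ _).trans (K_bullet_le _ _)
    · exact (φ i).lower ((hp' _ _ _).trans (kbar_bullet_le _ _)) ha
    · exact (hp' _ _ _).trans (K_bullet_le _ _)
    · exact (ψ i).lower ((hp' _ _ _).trans (kbar_bullet_le _ _)) ha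
  · rintro ⟨⟨e₁, he₁, h₁⟩, ⟨e₂, he₂, h₂⟩⟩
    obtain ⟨e, he, h⟩ := exists_one (ap (ap (ap (ap (var 0) (constK 𝒦)) (cst e₁ he₁))
      (cst e₂ he₂)) (ap (var 0) (cst _ kbar_mem)))
    refine ⟨e, he, fun i a ha => ?_⟩
    rcases ha with ⟨ht, ha⟩ | ⟨ht, ha⟩
    · refine (χ i).lower ((h a).trans (bullet_mono ?_ le_rfl)) (h₁ i _ ha)
      exact (bullet_mono (bullet_mono ht le_rfl) le_rfl).trans (K_bullet_le _ _)
    · refine (χ i).lower ((h a).trans (bullet_mono ?_ le_rfl)) (h₂ i _ ha)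
      exact (bullet_mono (bullet_mono ht le_rfl) le_rfl).trans (kbar_bullet_le _ _)

theorem entails_imp_iff : Entails χ (fun i => 𝒦.filteredOPCA.imp (φ i) (ψ i)) ↔
    Entails (fun i => pairs (χ i) (φ i)) ψ := by
  constructor
  · rintro ⟨e, he, h⟩
    obtain ⟨e', he', h'⟩ := exists_one (ap (ap (cst e he) (ap (var 0) (constK 𝒦)))
      (ap (var 0) (cst _ kbar_mem)))
    exact ⟨e', he', fun i a ha =>
      (ψ i).lower (h' a) (mem_imp_iff.1 (h i _ ha.1) _ ha.2)⟩
  · rintro ⟨e, he, h⟩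
    obtain ⟨p, hp, hp'⟩ := exists_pair 𝒦
    obtain ⟨e', he', h'⟩ := exists_two
      (ap (cst e he) (ap (ap (cst p hp) (var 1)) (var 0)))
    refine ⟨e', he', fun i a ha => mem_imp_iff.2 (fun b hb =>
      (ψ i).lower (h' a b) (h i _ ⟨?_, ?_⟩))⟩
    · exact (χ i).lower ((hp' _ _ _).trans (K_bullet_le _ _)) ha
    · exact (φ i).lower ((hp' _ _ _).trans (kbar_bullet_le _ _)) hb

/-- The same realizer works on both sides, as realizers do not depend on the index. The same is true
of `inter`. -/
theorem union_entails_iff (f : I → J) (ψ : J → LowerSet 𝒦.ClosedSet) :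
    Entails (union f φ) ψ ↔ Entails φ (fun i => ψ (f i)) := by
  constructor
  · rintro ⟨e, he, h⟩
    exact ⟨e, he, fun i a ha => h (f i) a ⟨i, rfl, ha⟩⟩
  · rintro ⟨e, he, h⟩
    refine ⟨e, he, ?_⟩
    rintro _ a ⟨i, rfl, ha⟩
    exact h i a ha

theorem entails_inter_iff (f : I → J) (ψ : J → LowerSet 𝒦.ClosedSet) :
    Entails ψ (inter f φ) ↔ Entails (fun i => ψ (f i)) φ := by
  constructor
  · rintro ⟨e, he, h⟩
    exact ⟨e, he, fun i a ha => h (f i) a ha i rfl⟩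
  · rintro ⟨e, he, h⟩
    refine ⟨e, he, ?_⟩
    rintro _ a ha i rfl
    exact h i a ha

end Entails

variable (𝒦) in
/-- The tripos structure on the Set-indexed preorder of downsets. -/
noncomputable def downTripos : 𝒦.filteredOPCA.downIndexed.Tripos where
  top := (⊤ : LowerSet 𝒦.ClosedSet)
  bot := (⊥ : LowerSet 𝒦.ClosedSet)
  inf := pairs
  sup := tagged
  himp := 𝒦.filteredOPCA.imp
  ex := union
  all := inter
  le_top _ := downIndexed_le_of_subset (fun _ _ _ => trivial)
  bot_le _ := downIndexed_le_of_subset (fun _ _ h => h.elim)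
  le_inf_iff φ ψ χ := downIndexed_le_iff.trans ((entails_pairs_iff φ ψ χ).trans
    (and_congr downIndexed_le_iff.symm downIndexed_le_iff.symm))
  sup_le_iff φ ψ χ := downIndexed_le_iff.trans ((tagged_entails_iff φ ψ χ).trans
    (and_congr downIndexed_le_iff.symm downIndexed_le_iff.symm))
  le_himp_iff φ ψ χ :=
    downIndexed_le_iff.trans ((entails_imp_iff φ ψ χ).trans downIndexed_le_iff.symm)
  ex_le_iff f φ ψ :=
    downIndexed_le_iff.trans ((union_entails_iff φ f ψ).trans downIndexed_le_iff.symm)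
  le_all_iff f φ ψ :=
    downIndexed_le_iff.trans ((entails_inter_iff φ f ψ).trans downIndexed_le_iff.symm)
  ex_beckChevalley f g φ := by
    constructor
    · refine downIndexed_le_of_subset ?_
      rintro k a ⟨i, hi, ha⟩
      exact ⟨⟨(k, i), hi.symm⟩, rfl, ha⟩
    · refine downIndexed_le_of_subset ?_
      rintro _ a ⟨⟨⟨k, i⟩, hi⟩, rfl, ha⟩
      exact ⟨i, hi.symm, ha⟩
  all_beckChevalley f g φ := by
    constructor
    · refine downIndexed_le_of_subset ?_
      rintro _ a ha ⟨⟨k, i⟩, hi⟩ rfl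
      exact ha i hi.symm
    · refine downIndexed_le_of_subset ?_
      intro k a ha i hi
      exact ha ⟨(k, i), hi.symm⟩ rfl

/-! ### Implication and double negation -/

/-- The least truth value. -/
def bot (𝒦 : AKS.{u}) : 𝒦.ClosedSet := closure Set.univ

theorem bot_le (a : 𝒦.ClosedSet) : bot 𝒦 ≤ a := fun _ _ => subset_closure _ (Set.mem_univ _)

/-- Implication of closed sets of stacks. -/
def arrow (a b : 𝒦.ClosedSet) : 𝒦.ClosedSet :=
  closure {ρ | ∃ s ∈ 𝒦.orthTerms a.carrier, ∃ π ∈ b.carrier, ρ = 𝒦.push s π}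

theorem push_mem_arrow {a b : 𝒦.ClosedSet} {s : 𝒦.Term} {π : 𝒦.Stack}
    (hs : s ∈ 𝒦.orthTerms a.carrier) (hπ : π ∈ b.carrier) : 𝒦.push s π ∈ (arrow a b).carrier :=
  subset_closure _ ⟨s, hs, π, hπ, rfl⟩

theorem arrow_bullet_le (a b : 𝒦.ClosedSet) : arrow a b ⬝ a ≤ b :=
  fun _ hπ => mem_bullet (fun _ hs => push_mem_arrow hs hπ)

/-- The infimum of a set of closed sets of stacks. -/
def inf (V : Set 𝒦.ClosedSet) : 𝒦.ClosedSet := closure {ρ | ∃ a ∈ V, ρ ∈ a.carrier}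

theorem inf_le {V : Set 𝒦.ClosedSet} {a : 𝒦.ClosedSet} (ha : a ∈ V) : inf V ≤ a :=
  fun _ hρ => subset_closure _ ⟨a, ha, hρ⟩

theorem le_inf {V : Set 𝒦.ClosedSet} {b : 𝒦.ClosedSet} (h : ∀ a ∈ V, b ≤ a) : b ≤ inf V :=
  closure_subset (fun _ ⟨a, ha, hρ⟩ => h a ha hρ)

variable (𝒦) in
/-- Uniformly, application can be internalized as implication. -/
theorem exists_le_arrow :
    ∃ e ∈ 𝒦.Filter, ∀ a b c : 𝒦.ClosedSet, a ⬝ b ≤ c → e ⬝ a ≤ arrow b c := by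
  let i := 𝒦.app (𝒦.app 𝒦.S 𝒦.K) 𝒦.K
  have hi : i ∈ 𝒦.QP :=
    𝒦.app_mem _ (𝒦.app_mem _ 𝒦.S_mem _ 𝒦.K_mem) _ 𝒦.K_mem
  have i_pole : ∀ t π, (t, π) ∈ 𝒦.pole → (i, 𝒦.push t π) ∈ 𝒦.pole := fun t π h =>
    𝒦.pole_app _ _ _ (𝒦.pole_app _ _ _ (𝒦.pole_S _ _ _ _ (𝒦.pole_app _ _ _
      (𝒦.pole_app _ _ _ (𝒦.pole_K _ _ _ h)))))
  -- The pole passes from `(t, s.π)` to `(t s, π)` but not back. The term `e` expands: against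
  -- `t.s.π` it reduces to `i (t s)` against `π`.
  let e := 𝒦.app 𝒦.S (𝒦.app 𝒦.K i)
  refine ⟨ofTerm e, ofTerm_mem_filter (𝒦.app_mem _ 𝒦.S_mem _
    (𝒦.app_mem _ 𝒦.K_mem _ hi)), fun a b c h => closure_subset ?_⟩
  rintro _ ⟨s, hs, π, hπ, rfl⟩
  refine mem_bullet (fun t ht => mem_ofTerm.2 ?_)
  have h1 : (𝒦.app t s, π) ∈ 𝒦.pole := app_mem_bullet ht hs π (h hπ)
  exact 𝒦.pole_app _ _ _ (𝒦.pole_S _ _ _ _ (𝒦.pole_app _ _ _ (𝒦.pole_app _ _ _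
    (𝒦.pole_app _ _ _ (𝒦.pole_K _ _ _ (i_pole _ _ h1))))))

variable (𝒦) in
/-- Uniformly, double negations can be eliminated. -/
theorem exists_nn_le :
    ∃ e ∈ 𝒦.Filter, ∀ a : 𝒦.ClosedSet, e ⬝ arrow (arrow a (bot 𝒦)) (bot 𝒦) ≤ a := by
  refine ⟨ofTerm 𝒦.cc, ofTerm_mem_filter 𝒦.cc_mem, fun a π hπ => ?_⟩
  -- The rule for `cc` leaves `t` against `k_π.π`. Here `k_π` realizes the negation of `a` because
  -- `π ∈ a`, and `π` belongs to `⊥` as every stack does.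
  refine mem_bullet (fun t ht => mem_ofTerm.2 (𝒦.pole_cc _ _ (ht _ ?_)))
  refine push_mem_arrow ?_ (bot_le a hπ)
  have h : 𝒦.k π ∈ 𝒦.orthTerms {ρ | ∃ s ∈ 𝒦.orthTerms a.carrier,
      ∃ π ∈ (bot 𝒦).carrier, ρ = 𝒦.push s π} := by
    rintro _ ⟨s, hs, π', -, rfl⟩
    exact 𝒦.pole_k _ _ _ (hs π hπ)
  exact fun ρ hρ => hρ _ h

/-! ### The reflection of downsets onto closed sets of stacks -/

/-- The infimum of the negations of the elements of a downset. -/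
def infNeg (V : LowerSet 𝒦.ClosedSet) : 𝒦.ClosedSet :=
  inf {c | ∃ b ∈ V, c = arrow b (bot 𝒦)}

theorem infNeg_le {V : LowerSet 𝒦.ClosedSet} {b : 𝒦.ClosedSet} (hb : b ∈ V) :
    infNeg V ≤ arrow b (bot 𝒦) :=
  inf_le (V := {c | ∃ b ∈ V, c = arrow b (bot 𝒦)}) ⟨b, hb, rfl⟩

theorem infNeg_bullet_le {V : LowerSet 𝒦.ClosedSet} {b : 𝒦.ClosedSet} (hb : b ∈ V) :
    infNeg V ⬝ b ≤ bot 𝒦 :=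
  (bullet_mono (infNeg_le hb) le_rfl).trans (arrow_bullet_le _ _)

variable (𝒦) in
-- One realizer serves all `b`, so it passes to the infimum: every refutation of `V` is uniformly
-- below `infNeg V`.
theorem exists_le_infNeg : ∃ e ∈ 𝒦.Filter, ∀ (a : 𝒦.ClosedSet) (V : LowerSet 𝒦.ClosedSet),
    (∀ b ∈ V, a ⬝ b ≤ bot 𝒦) → e ⬝ a ≤ infNeg V := by
  obtain ⟨e, he, h⟩ := exists_le_arrow 𝒦
  refine ⟨e, he, fun a V h' => le_inf ?_⟩
  rintro _ ⟨b, hb, rfl⟩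
  exact h _ _ _ (h' b hb)

/-- The double negation of the union of a downset. -/
def join (V : LowerSet 𝒦.ClosedSet) : 𝒦.ClosedSet := arrow (infNeg V) (bot 𝒦)

theorem join_bullet_le (V : LowerSet 𝒦.ClosedSet) : join V ⬝ infNeg V ≤ bot 𝒦 :=
  arrow_bullet_le _ _

variable (𝒦) in
theorem exists_le_join : ∃ e ∈ 𝒦.Filter, ∀ (V : LowerSet 𝒦.ClosedSet), ∀ a ∈ V,
    e ⬝ a ≤ join V := by
  obtain ⟨e₁, he₁, h₁⟩ := exists_le_arrow 𝒦
  obtain ⟨e₂, he₂, h₂⟩ := exists_two (𝒦 := 𝒦) (ap (var 0) (var 1))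
  obtain ⟨e, he, h⟩ := exists_one (ap (cst e₁ he₁) (ap (cst e₂ he₂) (var 0)))
  refine ⟨e, he, fun V a ha => (h a).trans (h₁ _ _ _ ((h₂ _ _).trans ?_))⟩
  exact infNeg_bullet_le ha

/-- The principal downset of a closed set of stacks. -/
def principal (a : 𝒦.ClosedSet) : LowerSet 𝒦.ClosedSet := LowerSet.Iic a

theorem mem_principal {a b : 𝒦.ClosedSet} : a ∈ principal b ↔ a ≤ b := Iff.rfl

/-- For the backward direction, a refutation `r` of `ψ i` gives the refutation `b ↦ r (e b)` of `φ
i`, which contradicts `join (φ i)`. This proves the double negation of `ψ i`, which `cc` removes. -/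
theorem join_entails_iff {I : Type u} (φ : I → LowerSet 𝒦.ClosedSet) (ψ : I → 𝒦.ClosedSet) :
    (∃ e ∈ 𝒦.Filter, ∀ i, e ⬝ join (φ i) ≤ ψ i) ↔
      Entails φ (fun i => principal (ψ i)) := by
  constructor
  · rintro ⟨e, he, h⟩
    obtain ⟨e₁, he₁, h₁⟩ := exists_le_join 𝒦
    obtain ⟨e₂, he₂, h₂⟩ := exists_one (ap (cst e he) (ap (cst e₁ he₁) (var 0)))
    exact ⟨e₂, he₂, fun i a ha => mem_principal.2
      ((h₂ a).trans ((bullet_mono le_rfl (h₁ _ _ ha)).trans (h i)))⟩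
  · rintro ⟨e, he, h⟩
    obtain ⟨e₁, he₁, h₁⟩ := exists_le_infNeg 𝒦
    obtain ⟨e₂, he₂, h₂⟩ := exists_le_arrow 𝒦
    obtain ⟨e₃, he₃, h₃⟩ := exists_nn_le 𝒦
    -- `e₄ r b` computes `r (e b)`, `e₅ j r` feeds the resulting refutation to `j`, and `e₆` adds
    -- the elimination of the double negation.
    obtain ⟨e₄, he₄, h₄⟩ := exists_two (ap (var 1) (ap (cst e he) (var 0)))
    obtain ⟨e₅, he₅, h₅⟩ := exists_two
      (ap (var 1) (ap (cst e₁ he₁) (ap (cst e₄ he₄) (var 0))))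
    obtain ⟨e₆, he₆, h₆⟩ := exists_one
      (ap (cst e₃ he₃) (ap (cst e₂ he₂) (ap (cst e₅ he₅) (var 0))))
    refine ⟨e₆, he₆, fun i => (h₆ _).trans
      ((bullet_mono le_rfl (h₂ _ (arrow (ψ i) (bot 𝒦)) (bot 𝒦) ?_)).trans (h₃ (ψ i)))⟩
    refine (h₅ _ _).trans ((bullet_mono le_rfl (h₁ _ (φ i) ?_)).trans (join_bullet_le _))
    intro b hb
    refine (h₄ _ _).trans ((bullet_mono le_rfl ?_).trans (arrow_bullet_le _ _))
    exact mem_principal.1 (h i b hb)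

variable (𝒦) in
/-- The truth value of which the complement is taken. -/
def botDownset : LowerSet 𝒦.ClosedSet := principal (bot 𝒦)

theorem mem_imp_bot_iff {V : LowerSet 𝒦.ClosedSet} {a : 𝒦.ClosedSet} :
    a ∈ 𝒦.filteredOPCA.imp V (botDownset 𝒦) ↔ ∀ b ∈ V, a ⬝ b ≤ bot 𝒦 :=
  mem_imp_iff

/-- By `exists_le_infNeg` and `infNeg_bullet_le`, the downset of refutations of `V` is uniformly
equivalent to the principal downset of `infNeg V`. Negating once more yields `join V`, both here and
in `nn_entails_join`. -/
theorem join_entails_nn {I : Type u} (φ : I → LowerSet 𝒦.ClosedSet) :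
    Entails (fun i => principal (join (φ i))) (fun i => 𝒦.filteredOPCA.imp
      (𝒦.filteredOPCA.imp (φ i) (botDownset 𝒦)) (botDownset 𝒦)) := by
  obtain ⟨e₁, he₁, h₁⟩ := exists_le_infNeg 𝒦
  obtain ⟨e₂, he₂, h₂⟩ := exists_two (ap (var 1) (ap (cst e₁ he₁) (var 0)))
  refine ⟨e₂, he₂, fun i a ha => mem_imp_bot_iff.2 (fun b hb => (h₂ a b).trans ?_)⟩
  exact (bullet_mono (mem_principal.1 ha) (h₁ b (φ i) (mem_imp_bot_iff.1 hb))).trans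
    (join_bullet_le _)

theorem nn_entails_join {I : Type u} (φ : I → LowerSet 𝒦.ClosedSet) :
    Entails (fun i => 𝒦.filteredOPCA.imp (𝒦.filteredOPCA.imp (φ i) (botDownset 𝒦))
      (botDownset 𝒦)) (fun i => principal (join (φ i))) := by
  obtain ⟨e, he, h⟩ := exists_le_arrow 𝒦
  refine ⟨e, he, fun i a ha => mem_principal.2 (h _ _ _ (mem_imp_bot_iff.1 ha _ ?_))⟩
  exact mem_imp_bot_iff.2 (fun b hb => infNeg_bullet_le hb)

variable (𝒦) in
/-- The reflection of downsets onto closed sets of stacks. -/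
noncomputable def reflection : (downTripos 𝒦).NegNegReflection 𝒦.krivineTripos (botDownset 𝒦) where
  F := join
  G := principal
  adj φ ψ := krivineTripos_le_iff.trans ((join_entails_iff φ ψ).trans downIndexed_le_iff.symm)
  le_FG ψ := by
    obtain ⟨e, he, h⟩ := exists_le_join 𝒦
    exact krivineTripos_le_iff.2 ⟨e, he, fun i => h (principal (ψ i)) (ψ i) (mem_principal.2 le_rfl)⟩
  GF_le_nn φ := downIndexed_le_iff.2 (join_entails_nn φ)
  nn_le_GF φ := downIndexed_le_iff.2 (nn_entails_join φ)

theorem disjoint_botDownset_filter (h : 𝒦.Nondegenerate) :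
    Disjoint (botDownset 𝒦 : Set 𝒦.ClosedSet) 𝒦.Filter := by
  rw [Set.disjoint_left]
  rintro a ha ⟨t, ht, ht'⟩
  obtain ⟨π, hπ⟩ := h t ht'
  exact hπ (ht π (mem_principal.1 ha (subset_closure _ (Set.mem_univ π))))

end AKS

/-! ### The Krivine tripos as a Booleanization -/

namespace AKS

variable (𝒦 : AKS.{u})

/-- Entailment in the Booleanization is entailment between double negations. -/
theorem booleanization_le_iff {I : Type u} {φ ψ : I → LowerSet 𝒦.ClosedSet} :
    (𝒦.filteredOPCA.booleanization (botDownset 𝒦)).le φ ψ ↔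
      𝒦.krivineTripos.le (fun i => join (φ i)) (fun i => join (ψ i)) := by
  let T := downTripos 𝒦
  let L := reflection 𝒦
  -- Contraposition: `¬ψ ≤ ¬φ` iff `φ ≤ ¬¬ψ`, and `¬¬ψ` is `principal (join ψ)`.
  change 𝒦.filteredOPCA.downIndexed.le (fun i => T.himp (ψ i) (botDownset 𝒦))
    (fun i => T.himp (φ i) (botDownset 𝒦)) ↔ _
  constructor
  · intro h
    refine (L.adj _ _).2 (IndexedPreorder.le_trans _ (T.himp_intro ?_) (L.nn_le_GF ψ))
    intro δ h1 h2
    exact T.himp_elim (IndexedPreorder.le_trans _ h2 h) h1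
  · intro h
    have h' := IndexedPreorder.le_trans _ ((L.adj _ _).1 h) (L.GF_le_nn ψ)
    refine T.himp_intro ?_
    intro δ h1 h2
    exact T.himp_elim (IndexedPreorder.le_trans _ h2 h') h1

/-- The order of the Booleanization is pulled back along `join`, and `join (principal ψ)` is
isomorphic to `ψ`; so `join` and `principal` are mutually inverse. -/
theorem equivalent_booleanization :
    𝒦.krivineTripos.Equivalent (𝒦.filteredOPCA.booleanization (botDownset 𝒦)) := by
  let L := reflection 𝒦
  have hFG : ∀ {I : Type u} (ψ : I → 𝒦.ClosedSet),
      𝒦.krivineTripos.Iso (fun i => join (principal (ψ i))) ψ :=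
    fun ψ => ⟨L.FG_le ψ, L.le_FG ψ⟩
  refine ⟨⟨fun φ i => principal (φ i), ?_, ?_⟩, ⟨fun φ i => join (φ i), ?_, ?_⟩,
    fun φ => hFG φ, ?_⟩
  · intro I φ ψ h
    exact (booleanization_le_iff 𝒦).2 (L.F_mono (L.G_mono h))
  · exact fun f φ => ⟨IndexedPreorder.le_refl _ _, IndexedPreorder.le_refl _ _⟩
  · exact fun h => (booleanization_le_iff 𝒦).1 h
  · exact fun f φ => ⟨IndexedPreorder.le_refl _ _, IndexedPreorder.le_refl _ _⟩
  · intro I ψ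
    exact ⟨(booleanization_le_iff 𝒦).2 (hFG (fun i => join (ψ i))).1,
      (booleanization_le_iff 𝒦).2 (hFG (fun i => join (ψ i))).2⟩

end AKS

end KrivineTripos

/-! ### The theorem -/

theorem mainTheorem2 (𝒦 : KrivineTripos.AKS.{u}) :
    ∃ (A : KrivineTripos.FilteredOPCA.{u}) (U : LowerSet A.carrier),
      (𝒦.Nondegenerate → Disjoint (U : Set A.carrier) A.filter) ∧
      𝒦.krivineTripos.Equivalent (A.booleanization U) ∧
      ∃ (TK : 𝒦.krivineTripos.Tripos) (TD : A.downIndexed.Tripos),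
        Nonempty (TK.Obj ≌ KrivineTripos.Booleanization
          (KrivineTripos.closedSubtopos (TD.subterminal U)).FullSubcategory) :=
  ⟨𝒦.filteredOPCA, 𝒦.botDownset, 𝒦.disjoint_botDownset_filter, 𝒦.equivalent_booleanization,
    𝒦.reflection.tripos, 𝒦.downTripos, 𝒦.reflection.nonempty_equivalence _⟩
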